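/- **Setting.** Let $A$ be an affine space over a real vector space $L$, and let $\theta:A\times L\to\mathbb{R}$ be linear in the second argument with $\theta(\eta+\xi,\tau)=\theta(\eta,\tau)+[\xi,\tau]$ for a bilinear form $[\cdot,\cdot]:L\times L\to\mathbb{R}$. Put $\omega(\xi,\tau)=\frac12[\xi,\tau]-\frac12[\tau,\xi]$, $M=\{\tau:[\xi,\tau]=0\ \forall\xi\}$, $N=\{\tau:[\tau,\xi]=0\ \forall\xi\}$. Assume that $\omega$ is non-degenerate, that $M+N=L$, and that $\theta(\eta,\cdot)$ vanishes on $M$ for all $\eta$. Let $q:L\to Q:=L/M$ be the quotient map; $[\xi,\cdot]$ is regarded as a linear form on $Q$. Let $\Omega:Q\times Q\to\mathbb{C}$ be an *admissible* form: symmetric and real bilinear, with positive definite real part, such that $(Q,\Re\Omega)$ is a separable Hilbert space, $\Im\Omega$ is continuous, and the continuous linear forms on $Q$ are exactly the maps $[\xi,\cdot]$, $\xi\in L$. ($L$ may have infinite dimension.) For a real Hilbert space $E$ let $\hat E\supseteq E$ be the algebraic dual of its topological dual $E^\star$, with the $\sigma$-algebra generated by the evaluations at the $\ell\in E^\star$.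 **Schrödinger representation.** Let $\nu_Q$ be the Gaussian measure on $\hat Q$ for which each $\ell\in Q^\star$ has law $N(0,\frac12\|\ell\|^2)$ (formally $\mathrm{d}\nu_Q=e^{-\Re\Omega(\phi,\phi)}\mathrm{d}\mu_Q$). For $\tau,\eta\in A$ and $v=\eta-\tau$ let $$\hat K^{\mathrm S,\eta}_\tau(\phi)=\exp\left(\mathrm{i}\theta(\tau,v)-\tfrac12\Omega(q(v),q(v))-\mathrm{i}[v,\phi]-\Omega(q(v),\phi)\right),$$ extended from $Q$ to $\hat Q$. The space $\mathcal{H}^{\tilde{\mathrm S}}$ consists of the families $(\psi^{\mathrm S,\eta})_{\eta\in A}$ in $\mathrm{L}^2(\hat Q,\nu_Q)$ that have representatives with $\psi^{\mathrm S,\eta'}(\phi)=\psi^{\mathrm S,\eta}(\phi+q(\eta'-\eta))\,\hat K^{\mathrm S,\eta'}_\eta(\phi)$ for all $\eta,\eta',\phi$; $\psi^{\mathrm S,\eta}$ is the $\eta$-reduced wave function of the state. **Holomorphic representation.** A *compatible complex structure* is a linear map $J:L\to L$ with $J^2=-\mathrm{id}$ and $\omega(J\cdot,J\cdot)=\omega$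 such that $g(\tau,\xi)=2\omega(\tau,J\xi)$ is positive definite and makes $L$ a separable Hilbert space in which $[\cdot,\cdot]$ is continuous. It *corresponds* to $\Omega$ if $\Omega(\phi,\phi')=g(j\phi,j\phi')-\mathrm{i}[j\phi,\phi']$, where $j:Q\to L$ is the linear section of $q$ with values in $JM$. Let $\{\tau,\xi\}=g(\tau,\xi)+2\mathrm{i}\omega(\tau,\xi)$, and let $\nu_L$ be the Gaussian measure on $\hat L$ for which each $\ell\in L^\star$ has law $N(0,\|\ell\|^2)$. Let $\mathrm{H}^2(\hat L,\nu_L)$ be the closure in $\mathrm{L}^2(\hat L,\nu_L)$ of the square-integrable holomorphic cylinder functions $x\mapsto p(\{\sigma_1,x\},\dots,\{\sigma_n,x\})$, with $p$ entire and $\sigma_i\in L$; its elements are restricted to $L$ by taking pointwise limits on $L$ of such functions converging in $\mathrm{L}^2$. For $\eta\in A$ let $$\alpha^\eta(\zeta)=\exp\left(\tfrac{\mathrm i}{2}\theta(\eta,\zeta-\eta)+\tfrac{\mathrm i}{2}\theta(\zeta,\zeta-\eta)-\tfrac14 g(\zeta-\eta,\zeta-\eta)\right),\qquad \zeta\in A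 .$$ The space $\mathcal{H}^{\hat{\mathrm H}}$ consists of the functions $\psi:A\to\mathbb{C}$ such that for every $\eta\in A$ one has $\psi(\zeta)=\psi^{\mathrm H,\eta}(\zeta-\eta)\,\alpha^\eta(\zeta)$ with $\psi^{\mathrm H,\eta}$ the restriction to $L$ of an element of $\mathrm{H}^2(\hat L,\nu_L)$. The holomorphic coherent state of $\tau\in A$ is $\hat K^{\hat{\mathrm H}}_\tau=\alpha^\tau$. **Theorem.** There is exactly one compatible complex structure $J$ corresponding to $\Omega$. For this $J$, passing to the $\eta$-reduced wave function identifies $\mathcal{H}^{\tilde{\mathrm S}}$ with $\mathrm{L}^2(\hat Q,\nu_Q)$, and $\psi\mapsto\psi^{\mathrm H,\eta}$ identifies $\mathcal{H}^{\hat{\mathrm H}}$ with $\mathrm{H}^2(\hat L,\nu_L)$; the resulting Hilbert space structures on $\mathcal{H}^{\tilde{\mathrm S}}$ and $\mathcal{H}^{\hat{\mathrm H}}$ do not depend on $\eta\in A$. There is an isometric isomorphism of Hilbert spaces $\hat{\mathcal B}:\mathcal{H}^{\tilde{\mathrm S}}\to\mathcal{H}^{\hat{\mathrm H}}$ such that for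 every $\tau\in A$ it maps the state whose $\eta$-reduced wave function is $\hat K^{\mathrm S,\eta}_\tau$, for every base point $\eta\in A$, to $\hat K^{\hat{\mathrm H}}_\tau$. -/

import Mathlib

open MeasureTheory ProbabilityTheory Filter Topology
open scoped NNReal ENNReal

noncomputable section

namespace AffineFieldTheory

/-! ### Inner products given by bilinear forms -/

/-- A symmetric positive definite real bilinear form. -/
structure InnerForm (V : Type*) [AddCommGroup V] [Module ℝ V] where
  form : V →ₗ[ℝ] V →ₗ[ℝ] ℝ
  symm : ∀ x y, form x y = form y x
  pos : ∀ x, x ≠ 0 → 0 < form x x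

namespace InnerForm

variable {V : Type*} [AddCommGroup V] [Module ℝ V]

@[reducible]
def core (b : InnerForm V) : InnerProductSpace.Core ℝ V where
  inner x y := b.form x y
  conj_inner_symm x y := by simp [b.symm y x]
  re_inner_nonneg x := by
    by_cases hx : x = 0
    · simp [hx]
    · exact (b.pos x hx).le
  add_left x y z := by simp
  smul_left x y r := by simp
  definite x hx := by
    by_contra h
    exact (b.pos x h).ne' hx

/-- The vector space `V` with the inner product `b`. -/
def Space (_b : InnerForm V) : Type _ := V

instance (b : InnerForm V) : NormedAddCommGroup b.Space :=
  @InnerProductSpace.Core.toNormedAddCommGroup ℝ V _ _ _ b.core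

instance (b : InnerForm V) : InnerProductSpace ℝ b.Space :=
  @InnerProductSpace.ofCore ℝ V _ _ _ b.core.toCore

/-- The identity map `V → (V, b)`. -/
def toSpace (b : InnerForm V) : V ≃ₗ[ℝ] b.Space where
  toFun x := x
  invFun x := x
  map_add' _ _ := rfl
  map_smul' _ _ := rfl
  left_inv _ := rfl
  right_inv _ := rfl

theorem inner_toSpace (b : InnerForm V) (x y : V) :
    inner ℝ (b.toSpace x) (b.toSpace y) = b.form x y := rfl

end InnerForm

/-! ### The extension of a Hilbert space carrying its Gaussian measures -/

section Gaussian

theorem integral_cexp_sum (ι : Type*) (s : Finset ι) (a : ι → ℝ) :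
    ∫ w, Complex.exp (Complex.I * ((∑ i ∈ s, a i * w i : ℝ) : ℂ))
      ∂(Measure.infinitePi fun _ : ι => gaussianReal 0 1) =
    Complex.exp (-((∑ i ∈ s, a i ^ 2 : ℝ) : ℂ) / 2) := by
  have hind : iIndepFun (fun (i : s) (w : ι → ℝ) => w i)
      (Measure.infinitePi fun _ : ι => gaussianReal 0 1) :=
    iIndepFun.precomp (g := fun i : s => (i : ι)) Subtype.val_injective
      (iIndepFun_infinitePi (X := fun _ w => w) (fun _ => measurable_id))
  have h1 := iIndepFun.integral_fun_prod_comp (𝕜 := ℂ) (ι := s) hind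
    (f := fun i x => Complex.exp (Complex.I * ((a i * x : ℝ) : ℂ)))
    (fun i => (measurable_pi_apply _).aemeasurable) (fun i => by
      apply Continuous.aestronglyMeasurable; fun_prop)
  have h2 : ∀ i : s, ∫ w : ι → ℝ, Complex.exp (Complex.I * ((a i * w i : ℝ) : ℂ))
      ∂(Measure.infinitePi fun _ : ι => gaussianReal 0 1)
      = Complex.exp (-((a i ^ 2 : ℝ) : ℂ) / 2) := by
    intro i
    have h3 := charFun_gaussianReal (μ := 0) (v := 1) (a i)
    rw [charFun_apply_real, ← Measure.infinitePi_map_eval (fun _ : ι => gaussianReal 0 1) (i : ι),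
      integral_map (measurable_pi_apply _).aemeasurable
        (by apply Continuous.aestronglyMeasurable; fun_prop)] at h3
    calc _ = ∫ w : ι → ℝ, Complex.exp (↑(a i) * ↑(w i) * Complex.I)
          ∂(Measure.infinitePi fun _ : ι => gaussianReal 0 1) := by
          congr 1; funext w; push_cast; ring_nf
      _ = _ := h3
      _ = _ := by push_cast; congr 1; simp; ring
  simp only [h2] at h1
  simp only [← Complex.exp_sum] at h1
  convert! h1 using 2
  · funext w
    congr 1
    rw [← Finset.mul_sum, ← Complex.ofReal_sum, Finset.sum_coe_sort s (fun i => a i * w i)]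
  · rw [← Finset.sum_div, Finset.sum_neg_distrib, ← Complex.ofReal_sum,
      Finset.sum_coe_sort s (fun i => a i ^ 2)]

theorem exists_isonormal (H : Type*) [NormedAddCommGroup H] [InnerProductSpace ℝ H]
    [CompleteSpace H] :
    ∃ (w : Set H) (P : Measure (w → ℝ)) (W : H →ₗᵢ[ℝ] Lp ℝ 2 P),
      ∀ h, P.map (W h) = gaussianReal 0 (‖h‖₊ ^ 2) := by
  obtain ⟨w, e, -⟩ := exists_hilbertBasis ℝ H
  set P : Measure (w → ℝ) := Measure.infinitePi fun _ : w => gaussianReal 0 1 with hP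
  have hmap : ∀ i : w, P.map (fun x : w → ℝ => x i) = gaussianReal 0 1 := fun i =>
    Measure.infinitePi_map_eval (fun _ : w => gaussianReal 0 1) i
  have hmem : ∀ i : w, MemLp (fun x : w → ℝ => x i) 2 P := fun i => by
    have := memLp_id_gaussianReal (μ := 0) (v := 1) 2
    rw [← hmap i] at this
    exact this.comp_of_map (measurable_pi_apply _).aemeasurable
  have h0 : ∀ i : w, ∫ x : w → ℝ, x i ∂P = 0 := fun i => by
    have := integral_id_gaussianReal (μ := 0) (v := 1)
    rwa [← hmap i, integral_map (measurable_pi_apply _).aemeasurable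
      (by apply Continuous.aestronglyMeasurable; fun_prop)] at this
  have hone : ∀ i : w, ∫ x : w → ℝ, x i * x i ∂P = 1 := fun i => by
    have h := variance_id_gaussianReal (μ := 0) (v := 1)
    rw [variance_eq_sub (memLp_id_gaussianReal 2)] at h
    simp only [integral_id_gaussianReal, id, Pi.pow_apply] at h
    rw [← hmap i, integral_map (measurable_pi_apply _).aemeasurable
      (by apply Continuous.aestronglyMeasurable; fun_prop)] at h
    simpa [sq] using h
  have horth : Orthonormal ℝ fun i : w => (hmem i).toLp := by
    classical
    rw [orthonormal_iff_ite]
    intro i j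
    rw [L2.inner_def]
    have : ∫ x, inner ℝ ((hmem i).toLp (fun x : w → ℝ => x i) x) ((hmem j).toLp _ x) ∂P
        = ∫ x : w → ℝ, x j * x i ∂P := by
      apply integral_congr_ae
      filter_upwards [(hmem i).coeFn_toLp, (hmem j).coeFn_toLp] with x h1 h2
      rw [h1, h2]; rfl
    rw [this]
    split_ifs with hij
    · subst hij; exact hone i
    · have hind : iIndepFun (fun (i : w) (x : w → ℝ) => x i) P :=
        iIndepFun_infinitePi (X := fun _ w => w) (fun _ => measurable_id)
      rw [(hind.indepFun (Ne.symm hij)).integral_fun_mul_eq_mul_integral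
        (measurable_pi_apply _).aestronglyMeasurable (measurable_pi_apply _).aestronglyMeasurable,
        h0 i, mul_zero]
  have hoF := horth.orthogonalFamily
  let W : H →ₗᵢ[ℝ] Lp ℝ 2 P := hoF.linearIsometry.comp e.repr.toLinearIsometry
  have hWe : ∀ i, W (e i) = (hmem i).toLp := by
    classical
    intro i
    change hoF.linearIsometry (e.repr (e i)) = _
    rw [e.repr_self, hoF.linearIsometry_apply_single]
    simp
  have hcont : Continuous fun h : H => ∫ x, Complex.exp (Complex.I * ((W h x : ℝ) : ℂ)) ∂P := by
    have hint : ∀ h, Integrable (fun x => Complex.exp (Complex.I * ((W h x : ℝ) : ℂ))) P := by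
      intro h
      refine Integrable.of_bound (C := 1) ?_ (ae_of_all _ fun x => ?_)
      · have := (Lp.aestronglyMeasurable (W h))
        have hc : Continuous fun y : ℝ => Complex.exp (Complex.I * (y : ℂ)) := by fun_prop
        exact hc.comp_aestronglyMeasurable this
      · rw [mul_comm, Complex.norm_exp_ofReal_mul_I]
    have : LipschitzWith 1 fun h : H =>
        ∫ x, Complex.exp (Complex.I * ((W h x : ℝ) : ℂ)) ∂P := by
      refine LipschitzWith.of_dist_le_mul fun h h' => ?_
      rw [dist_eq_norm, ← integral_sub (hint h) (hint h')]
      calc ‖∫ x, (Complex.exp (Complex.I * ((W h x : ℝ) : ℂ))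
              - Complex.exp (Complex.I * ((W h' x : ℝ) : ℂ))) ∂P‖
          ≤ ∫ x, ‖(W (h - h')) x‖ ∂P := by
            refine norm_integral_le_of_norm_le
              ((Lp.memLp (W (h - h'))).integrable (by norm_num)).norm ?_
            have := Lp.coeFn_sub (W h) (W h')
            rw [← map_sub] at this
            filter_upwards [this] with x hx
            rw [hx, Pi.sub_apply]
            have he : Complex.exp (Complex.I * ((W h x : ℝ) : ℂ))
              - Complex.exp (Complex.I * ((W h' x : ℝ) : ℂ))
              = Complex.exp (Complex.I * ((W h' x : ℝ) : ℂ)) *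
                (Complex.exp (Complex.I * ((W h x - W h' x : ℝ) : ℂ)) - 1) := by
              rw [mul_sub, ← Complex.exp_add]; push_cast; ring_nf
            rw [he, norm_mul, mul_comm Complex.I, Complex.norm_exp_ofReal_mul_I, one_mul]
            exact Real.norm_exp_I_mul_ofReal_sub_one_le
        _ ≤ ‖W (h - h')‖ := by
            have h1 := eLpNorm_le_eLpNorm_of_exponent_le (p := 1) (q := 2) (by norm_num)
              (Lp.aestronglyMeasurable (W (h - h')))
            rw [integral_norm_eq_lintegral_enorm (Lp.aestronglyMeasurable _),
              ← eLpNorm_one_eq_lintegral_enorm, Lp.norm_def]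
            exact ENNReal.toReal_mono (Lp.memLp _).2.ne h1
        _ = _ := by rw [W.norm_map, dist_eq_norm]; simp
    exact this.continuous
  have hchar : ∀ h : H, ∫ x, Complex.exp (Complex.I * ((W h x : ℝ) : ℂ)) ∂P
      = Complex.exp (-((‖h‖ ^ 2 : ℝ) : ℂ) / 2) := by
    intro h
    have hs := e.hasSum_repr h
    have hL := (hcont.tendsto h).comp hs
    have hR : Tendsto (fun s : Finset w =>
        Complex.exp (-((‖∑ i ∈ s, e.repr h i • e i‖ ^ 2 : ℝ) : ℂ) / 2)) atTop
        (𝓝 (Complex.exp (-((‖h‖ ^ 2 : ℝ) : ℂ) / 2))) := by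
      have hc : Continuous fun y : H => Complex.exp (-((‖y‖ ^ 2 : ℝ) : ℂ) / 2) := by fun_prop
      exact (hc.tendsto h).comp hs
    refine tendsto_nhds_unique hL (hR.congr fun s => ?_)
    have hn : ‖∑ i ∈ s, e.repr h i • e i‖ ^ 2 = ∑ i ∈ s, (e.repr h i) ^ 2 := by
      rw [← real_inner_self_eq_norm_sq, e.orthonormal.inner_sum]
      simp [sq]
    rw [hn, ← integral_cexp_sum]
    apply integral_congr_ae
    have hae : (W (∑ i ∈ s, e.repr h i • e i) : (w → ℝ) → ℝ) =ᵐ[P]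
        fun x => ∑ i ∈ s, e.repr h i * x i := by
      classical
      clear hn hR hL
      induction s using Finset.induction_on with
      | empty =>
        simp only [Finset.sum_empty, map_zero]
        exact Lp.coeFn_zero _ _ _
      | insert i s his ih =>
        simp only [Finset.sum_insert his, map_add, map_smul, hWe]
        filter_upwards [ih, Lp.coeFn_add (e.repr h i • (hmem i).toLp)
          (W (∑ i ∈ s, e.repr h i • e i)), Lp.coeFn_smul (e.repr h i) (hmem i).toLp,
          (hmem i).coeFn_toLp] with x h1 h2 h3 h4
        simp only [map_sum, map_smul, hWe] at h1 h2 ⊢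
        rw [h2, Pi.add_apply, h3, Pi.smul_apply, h4, h1, smul_eq_mul]
    filter_upwards [hae] with x hx
    simp only [hx]
  refine ⟨w, P, W, fun h => ?_⟩
  have hm : AEMeasurable (W h) P := (Lp.aestronglyMeasurable (W h)).aemeasurable
  have := Measure.isProbabilityMeasure_map hm
  refine Measure.ext_of_charFun ?_
  funext t
  rw [charFun_gaussianReal, charFun_apply_real,
    integral_map hm (by apply Continuous.aestronglyMeasurable; fun_prop)]
  have h1 := hchar (t • h)
  have h2 : ∫ x, Complex.exp (t * ((W h x : ℝ) : ℂ) * Complex.I) ∂P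
      = ∫ x, Complex.exp (Complex.I * ((W (t • h) x : ℝ) : ℂ)) ∂P := by
    apply integral_congr_ae
    have := Lp.coeFn_smul t (W h)
    rw [← map_smul] at this
    filter_upwards [this] with x hx
    rw [hx]; simp; ring_nf
  rw [h2, h1, norm_smul]
  congr 1
  push_cast
  simp only [mul_pow, Real.norm_eq_abs, ← Complex.ofReal_pow, sq_abs]
  push_cast
  ring

/-- The algebraic dual of the topological dual of `E`. -/
abbrev Extension (E : Type*) [NormedAddCommGroup E] [InnerProductSpace ℝ E] : Type _ :=
  Module.Dual ℝ (StrongDual ℝ E)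

variable {E : Type*} [NormedAddCommGroup E] [InnerProductSpace ℝ E]

/-- The cylinder σ-algebra: the smallest one for which all the evaluations `x ↦ x ℓ` are
measurable. -/
instance Extension.measurableSpace : MeasurableSpace (Extension E) :=
  MeasurableSpace.comap (fun (x : Extension E) (ℓ : StrongDual ℝ E) => x ℓ) MeasurableSpace.pi

/-- The canonical inclusion of `E` into its extension. -/
def Extension.incl (E : Type*) [NormedAddCommGroup E] [InnerProductSpace ℝ E] :
    E →ₗ[ℝ] Extension E where
  toFun φ :=
    { toFun := fun ℓ => ℓ φ
      map_add' := fun _ _ => rfl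
      map_smul' := fun _ _ => rfl }
  map_add' x y := by ext ℓ; simp
  map_smul' c x := by ext ℓ; simp

/-- `ν` is the centered Gaussian measure with variance `v` in each direction: every `ℓ` in the
topological dual has a normal law with variance `v ‖ℓ‖ ^ 2`. Equivalently, the image of `ν` in each
finite-dimensional quotient is proportional to `exp (- ‖x‖ ^ 2 / (2 v))` times Lebesgue measure. -/
def IsCanonicalGaussian (v : ℝ≥0) (ν : Measure (Extension E)) : Prop :=
  ∀ ℓ : StrongDual ℝ E, ν.map (fun x => x ℓ) = gaussianReal 0 (v * ‖ℓ‖₊ ^ 2)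

theorem measurable_extension_apply (ℓ : StrongDual ℝ E) :
    Measurable fun x : Extension E => x ℓ :=
  (measurable_pi_apply ℓ).comp (comap_measurable _)

theorem exists_isCanonicalGaussian [CompleteSpace E] (v : ℝ≥0) :
    ∃ ν : Measure (Extension E), IsCanonicalGaussian v ν := by
  obtain ⟨w, P, W, hW⟩ := exists_isonormal E
  let b := Module.Basis.ofVectorSpace ℝ (StrongDual ℝ E)
  let R : StrongDual ℝ E →ₗ[ℝ] Lp ℝ 2 P :=
    W.toLinearMap ∘ₗ (InnerProductSpace.toDual ℝ E).symm.toLinearEquiv.toLinearMap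
  let G : (w → ℝ) → Extension E := fun x => b.constr ℝ fun k => Real.sqrt v * R (b k) x
  have hG : ∀ x ℓ, G x ℓ = (b.repr ℓ).sum fun k c => c * (Real.sqrt v * R (b k) x) := by
    intro x ℓ
    simp only [G, b.constr_apply, smul_eq_mul]
  have hGm : Measurable G := by
    rw [measurable_comap_iff, measurable_pi_iff]
    intro ℓ
    simp only [Function.comp_def, hG, Finsupp.sum]
    exact Finset.measurable_fun_sum _ fun k _ => measurable_const.mul
      (measurable_const.mul (Lp.stronglyMeasurable (R (b k))).measurable)
  refine ⟨P.map G, fun ℓ => ?_⟩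
  rw [Measure.map_map (measurable_extension_apply ℓ) hGm]
  have hR : R ℓ = ∑ k ∈ (b.repr ℓ).support, (b.repr ℓ k) • R (b k) := by
    conv_lhs => rw [← b.linearCombination_repr ℓ]
    rw [Finsupp.linearCombination_apply, Finsupp.sum, map_sum]
    simp only [map_smul]
  have hsum : ∀ s : Finset _, ((∑ k ∈ s, (b.repr ℓ k) • R (b k) : Lp ℝ 2 P) : (w → ℝ) → ℝ)
      =ᵐ[P] fun x => ∑ k ∈ s, b.repr ℓ k * R (b k) x := by
    classical
    intro s
    induction s using Finset.induction_on with
    | empty => simpa using! Lp.coeFn_zero ℝ 2 P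
    | insert k s hk ih =>
      rw [Finset.sum_insert hk]
      filter_upwards [ih, Lp.coeFn_add (b.repr ℓ k • R (b k)) (∑ k ∈ s, (b.repr ℓ k) • R (b k)),
        Lp.coeFn_smul (b.repr ℓ k) (R (b k))] with x h1 h2 h3
      rw [h2, Pi.add_apply, h3, h1, Finset.sum_insert hk]
      rfl
  have hae : ((fun x : Extension E => x ℓ) ∘ G) =ᵐ[P] fun x => Real.sqrt v * R ℓ x := by
    filter_upwards [hsum (b.repr ℓ).support] with x hx
    rw [hR, hx, Function.comp_apply, hG, Finsupp.sum, Finset.mul_sum]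
    exact Finset.sum_congr rfl fun k _ => by ring
  have hRm : Measurable (R ℓ : (w → ℝ) → ℝ) := (Lp.stronglyMeasurable (R ℓ)).measurable
  rw [Measure.map_congr hae,
    ← Function.comp_def (fun y => Real.sqrt v * y) (R ℓ : (w → ℝ) → ℝ),
    ← Measure.map_map (measurable_const_mul _) hRm]
  have hlaw : P.map (R ℓ) = gaussianReal 0 (‖ℓ‖₊ ^ 2) := by
    have h := hW ((InnerProductSpace.toDual ℝ E).symm ℓ)
    rwa [LinearIsometryEquiv.nnnorm_map] at h
  rw [hlaw, gaussianReal_map_const_mul, mul_zero]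
  congr 2
  apply NNReal.eq
  simp

theorem IsCanonicalGaussian.isProbabilityMeasure {v : ℝ≥0} {ν : Measure (Extension E)}
    (h : IsCanonicalGaussian v ν) : IsProbabilityMeasure ν := by
  constructor
  have := congrArg (fun m => m Set.univ) (h 0)
  simpa [Measure.map_apply (measurable_extension_apply (0 : StrongDual ℝ E)) .univ] using this

theorem IsCanonicalGaussian.unique {v : ℝ≥0} {ν ν' : Measure (Extension E)}
    (h : IsCanonicalGaussian v ν) (h' : IsCanonicalGaussian v ν') : ν = ν' := by
  have := h.isProbabilityMeasure
  have := h'.isProbabilityMeasure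
  let i : Extension E → StrongDual ℝ E → ℝ := fun x ℓ => x ℓ
  have hi : Measurable i := comap_measurable _
  have key : ∀ I : Finset (StrongDual ℝ E),
      (ν.map i).map I.restrict = (ν'.map i).map I.restrict := by
    classical
    intro I
    have hI : Measurable (I.restrict : (StrongDual ℝ E → ℝ) → I → ℝ) := Finset.measurable_restrict I
    rw [Measure.map_map hI hi, Measure.map_map hI hi]
    have hm := hI.comp hi
    have := Measure.isProbabilityMeasure_map (μ := ν) hm.aemeasurable
    have := Measure.isProbabilityMeasure_map (μ := ν') hm.aemeasurable
    refine Measure.ext_of_charFunDual ?_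
    funext u
    rw [charFunDual_apply, charFunDual_apply,
      integral_map hm.aemeasurable (by apply Continuous.aestronglyMeasurable; fun_prop),
      integral_map hm.aemeasurable (by apply Continuous.aestronglyMeasurable; fun_prop)]
    let ℓ : StrongDual ℝ E := ∑ k : I, u (Pi.single k 1) • (k : StrongDual ℝ E)
    have hu : ∀ x : Extension E, u ((I.restrict ∘ i) x) = x ℓ := by
      intro x
      have hx := LinearMap.pi_apply_eq_sum_univ u.toLinearMap ((I.restrict ∘ i) x)
      have hd : ∀ k : I, (fun j : I => if k = j then (1 : ℝ) else 0) = Pi.single k 1 := by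
        intro k; ext j; simp [Pi.single_apply, eq_comm]
      simp only [hd] at hx
      refine hx.trans ?_
      simp only [ℓ, map_sum, map_smul, smul_eq_mul]
      exact Finset.sum_congr rfl fun k _ => mul_comm _ _
    simp only [hu]
    have hc : Continuous fun y : ℝ => Complex.exp ((y : ℂ) * Complex.I) := by fun_prop
    rw [← integral_map (f := fun y : ℝ => Complex.exp ((y : ℂ) * Complex.I))
        (measurable_extension_apply ℓ).aemeasurable hc.aestronglyMeasurable,
      ← integral_map (f := fun y : ℝ => Complex.exp ((y : ℂ) * Complex.I))
        (measurable_extension_apply ℓ).aemeasurable hc.aestronglyMeasurable, h ℓ, h' ℓ]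
  have := Measure.isProbabilityMeasure_map (μ := ν) hi.aemeasurable
  have := Measure.isProbabilityMeasure_map (μ := ν') hi.aemeasurable
  have hmap : ν.map i = ν'.map i := by
    refine IsProjectiveLimit.unique (P := fun I => (ν.map i).map I.restrict)
      (fun I => rfl) (fun I => (key I).symm)
  ext s hs
  obtain ⟨t, ht, rfl⟩ := hs
  have := congrArg (fun m => m t) hmap
  simpa only [Measure.map_apply hi ht] using this

/-- The centered Gaussian measure on the extension of the Hilbert space `E` with variance `v` in
each direction; see `exists_isCanonicalGaussian` and `IsCanonicalGaussian.unique`. -/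
def gaussian (E : Type*) [NormedAddCommGroup E] [InnerProductSpace ℝ E] (v : ℝ≥0) :
    Measure (Extension E) :=
  Classical.epsilon (IsCanonicalGaussian v)

theorem isCanonicalGaussian_gaussian [CompleteSpace E] (v : ℝ≥0) :
    IsCanonicalGaussian v (gaussian E v) :=
  Classical.epsilon_spec (exists_isCanonicalGaussian v)

end Gaussian

/-! ### Classical data -/

/-- The antisymmetrization `ω(ξ, ξ') = ([ξ, ξ'] - [ξ', ξ]) / 2`. -/
def symplecticForm {L : Type*} [AddCommGroup L] [Module ℝ L] (br : L →ₗ[ℝ] L →ₗ[ℝ] ℝ) :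
    L →ₗ[ℝ] L →ₗ[ℝ] ℝ :=
  (1 / 2 : ℝ) • (br - br.flip)

/-- An affine space `A` of solutions over `L` with its symplectic potential `θ`, equivariant with
respect to the bilinear form `[·,·]`. Here `LinearMap.ker bracket.flip` and `LinearMap.ker bracket`
are the subspaces `M = {τ : [ξ, τ] = 0 ∀ ξ}` and `N = {τ : [τ, ξ] = 0 ∀ ξ}`. -/
structure Theory (L A : Type*) [AddCommGroup L] [Module ℝ L] [AddTorsor L A] where
  θ : A → L →ₗ[ℝ] ℝ
  bracket : L →ₗ[ℝ] L →ₗ[ℝ] ℝ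
  equivariant : ∀ (η : A) (ξ τ : L), θ (ξ +ᵥ η) τ = θ η τ + bracket ξ τ
  nondegenerate : ∀ ξ, (∀ τ, symplecticForm bracket ξ τ = 0) → ξ = 0
  span : LinearMap.ker bracket.flip ⊔ LinearMap.ker bracket = ⊤
  /-- `θ` is adapted to the polarization `M`. -/
  adapted : ∀ (η : A), ∀ τ ∈ LinearMap.ker bracket.flip, θ η τ = 0

variable {L A : Type*} [AddCommGroup L] [Module ℝ L] [AddTorsor L A]

namespace Theory

variable (T : Theory L A)

/-- The symplectic form. -/
def ω : L →ₗ[ℝ] L →ₗ[ℝ] ℝ := symplecticForm T.bracket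

/-- The subspace defining the real (Schrödinger) polarization. -/
def M : Submodule ℝ L := LinearMap.ker T.bracket.flip

/-- The space `Q = L / M`. -/
abbrev Q : Type _ := L ⧸ T.M

/-- The quotient map `L → Q`. -/
def q : L →ₗ[ℝ] T.Q := T.M.mkQ

/-- `[ξ, ·]` as a linear form on `Q`. -/
def bracketQ (ξ : L) : T.Q →ₗ[ℝ] ℝ :=
  T.M.liftQ (T.bracket ξ) fun τ hτ => by
    have h : T.bracket.flip τ = 0 := hτ
    simpa using LinearMap.congr_fun h ξ

end Theory

/-! ### The Schrödinger representation -/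

/-- A symmetric bilinear form `Ω : Q × Q → ℂ` with positive definite real part. -/
structure VacuumForm (T : Theory L A) where
  form : T.Q →ₗ[ℝ] T.Q →ₗ[ℝ] ℂ
  symm : ∀ φ φ', form φ φ' = form φ' φ
  pos : ∀ φ, φ ≠ 0 → 0 < (form φ φ).re

namespace VacuumForm

variable {T : Theory L A} (Ω : VacuumForm T)

/-- The inner product on `Q` given by the real part of `Ω`. -/
def reForm : InnerForm T.Q where
  form := Ω.form.compr₂ Complex.reLm
  symm φ φ' := by simp [Ω.symm φ φ']
  pos φ h := by simpa using Ω.pos φ h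

/-- `Q` with the inner product given by the real part of `Ω`. -/
abbrev Space : Type _ := Ω.reForm.Space

def toSpace : T.Q ≃ₗ[ℝ] Ω.Space := Ω.reForm.toSpace

/-- The imaginary part of `Ω (φ, ·)`. -/
def imLeft (φ : T.Q) : Ω.Space →ₗ[ℝ] ℝ :=
  Complex.imLm ∘ₗ Ω.form φ ∘ₗ Ω.toSpace.symm.toLinearMap

/-- `[ξ, ·]` on `Q` with its inner product. -/
def bracketLeft (ξ : L) : Ω.Space →ₗ[ℝ] ℝ :=
  T.bracketQ ξ ∘ₗ Ω.toSpace.symm.toLinearMap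

/-- `Q` is a separable Hilbert space with respect to `Re Ω`, the imaginary part of `Ω` is continuous,
and the continuous linear forms on `Q` are exactly the maps `[ξ, ·]` for `ξ ∈ L`. -/
structure IsAdmissible : Prop where
  complete : CompleteSpace Ω.Space
  separable : TopologicalSpace.SeparableSpace Ω.Space
  continuous_im : Continuous fun p : Ω.Space × Ω.Space => Ω.imLeft (Ω.toSpace.symm p.1) p.2
  continuous_bracket : ∀ ξ : L, Continuous (Ω.bracketLeft ξ)
  exists_bracket : ∀ ℓ : StrongDual ℝ Ω.Space, ∃ ξ : L, ∀ φ, ℓ φ = Ω.bracketLeft ξ φ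

/-- The extension `Q̂` of `Q`. -/
abbrev QHat : Type _ := Extension Ω.Space

/-- The inclusion `Q → Q̂`. -/
def incl : T.Q →ₗ[ℝ] Ω.QHat := Extension.incl Ω.Space ∘ₗ Ω.toSpace.toLinearMap

/-- The Gaussian measure on `Q̂`, formally `exp (- Re Ω(φ, φ)) dμ(φ)`. -/
def νQ : Measure Ω.QHat := gaussian Ω.Space (1 / 2)

variable {Ω}

namespace IsAdmissible

variable (hΩ : Ω.IsAdmissible)

/-- `Im Ω(φ, ·)` as a continuous linear form. -/
def imDual (φ : T.Q) : StrongDual ℝ Ω.Space :=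
  ⟨Ω.imLeft φ, hΩ.continuous_im.comp (Continuous.prodMk_right (Ω.toSpace φ))⟩

/-- `[ξ, ·]` as a continuous linear form. -/
def bracketDual (ξ : L) : StrongDual ℝ Ω.Space :=
  ⟨Ω.bracketLeft ξ, hΩ.continuous_bracket ξ⟩

/-- The `η`-reduced Schrödinger wave function of the coherent state associated with `τ ∈ A`,
`φ ↦ exp (i θ(τ, v) - Ω(q v, q v) / 2 - i [v, φ] - Ω(q v, φ))` with `v = η - τ`, extended from `Q`
to `Q̂`. -/
def coherent (τ η : A) (φ : Ω.QHat) : ℂ :=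
  Complex.exp (Complex.I * (T.θ τ (η -ᵥ τ) : ℝ)
    - 1 / 2 * Ω.form (T.q (η -ᵥ τ)) (T.q (η -ᵥ τ))
    - Complex.I * (φ (hΩ.bracketDual (η -ᵥ τ)) : ℝ)
    - ((φ (innerSL ℝ (Ω.toSpace (T.q (η -ᵥ τ)))) : ℝ)
        + Complex.I * (φ (hΩ.imDual (T.q (η -ᵥ τ))) : ℝ)))

/-- On `Q` the function `coherent τ η` is the quotient `K τ (φ + c(η)) / K η (φ + c(η))` of the full
wave functions `K ζ (ζ') = exp (i θ(ζ, ζ' - ζ) - Ω(q(ζ' - ζ), q(ζ' - ζ)) / 2)`. -/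
theorem coherent_incl (τ η : A) (ξ : L) :
    hΩ.coherent τ η (Ω.incl (T.q ξ)) =
      Complex.exp (Complex.I * (T.θ τ ((ξ +ᵥ η) -ᵥ τ) : ℝ)
        - 1 / 2 * Ω.form (T.q ((ξ +ᵥ η) -ᵥ τ)) (T.q ((ξ +ᵥ η) -ᵥ τ))) /
      Complex.exp (Complex.I * (T.θ η ((ξ +ᵥ η) -ᵥ η) : ℝ)
        - 1 / 2 * Ω.form (T.q ((ξ +ᵥ η) -ᵥ η)) (T.q ((ξ +ᵥ η) -ᵥ η))) := by
  have h1 : T.θ η ξ = T.θ τ ξ + T.bracket (η -ᵥ τ) ξ := by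
    have := T.equivariant τ (η -ᵥ τ) ξ
    rwa [vsub_vadd] at this
  have h2 : Ω.incl (T.q ξ) (hΩ.bracketDual (η -ᵥ τ)) = T.bracket (η -ᵥ τ) ξ := rfl
  have h3 : Ω.incl (T.q ξ) (innerSL ℝ (Ω.toSpace (T.q (η -ᵥ τ))))
      = (Ω.form (T.q (η -ᵥ τ)) (T.q ξ)).re := rfl
  have h4 : Ω.incl (T.q ξ) (hΩ.imDual (T.q (η -ᵥ τ)))
      = (Ω.form (T.q (η -ᵥ τ)) (T.q ξ)).im := rfl
  have h5 : (((Ω.form (T.q (η -ᵥ τ)) (T.q ξ)).re : ℂ)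
      + Complex.I * (Ω.form (T.q (η -ᵥ τ)) (T.q ξ)).im) = Ω.form (T.q (η -ᵥ τ)) (T.q ξ) := by
    rw [mul_comm]; exact Complex.re_add_im _
  rw [coherent, ← Complex.exp_sub, h2, h3, h4, h5, vadd_vsub_assoc, vadd_vsub, map_add, map_add,
    map_add, h1]
  simp only [map_add, LinearMap.add_apply, Ω.symm (T.q ξ) (T.q (η -ᵥ τ))]
  congr 1
  push_cast
  ring

/-- The space of states of the Schrödinger representation. A state is a family of `η`-reduced wave
functions in `L²(Q̂, ν_Q)`, one for each base point `η`, with the transformation law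
`ψ^{η'}(φ) = ψ^{η}(φ + q(η' - η)) K^{η'}_η(φ)`. -/
def stateSpace : Submodule ℂ (A → Lp ℂ 2 Ω.νQ) where
  carrier := {Ψ | ∃ f : A → Ω.QHat → ℂ, (∀ η, Ψ η =ᵐ[Ω.νQ] f η) ∧
    ∀ η η' φ, f η' φ = f η (φ + Ω.incl (T.q (η' -ᵥ η))) * hΩ.coherent η η' φ}
  add_mem' := by
    rintro Ψ Φ ⟨f, hf, hf'⟩ ⟨g, hg, hg'⟩
    refine ⟨f + g, fun η => ?_, fun η η' φ => ?_⟩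
    · exact (Lp.coeFn_add _ _).trans ((hf η).add (hg η))
    · simp only [Pi.add_apply, hf' η η' φ, hg' η η' φ, add_mul]
  zero_mem' := ⟨0, fun η => Lp.coeFn_zero _ _ _, fun η η' φ => by simp⟩
  smul_mem' := by
    rintro c Ψ ⟨f, hf, hf'⟩
    refine ⟨c • f, fun η => ?_, fun η η' φ => ?_⟩
    · exact (Lp.coeFn_smul _ _).trans ((hf η).const_smul c)
    · simp only [Pi.smul_apply, hf' η η' φ, smul_eq_mul, mul_assoc]

end IsAdmissible

end VacuumForm

/-! ### The holomorphic representation -/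

/-- A complex structure on `L` that is compatible with the symplectic form and for which
`g(τ, ξ) = 2 ω(τ, J ξ)` is positive definite. -/
@[ext]
structure ComplexStructure (T : Theory L A) where
  J : L →ₗ[ℝ] L
  sq : ∀ ξ, J (J ξ) = -ξ
  symplectic : ∀ ξ τ, T.ω (J ξ) (J τ) = T.ω ξ τ
  pos : ∀ ξ, ξ ≠ 0 → 0 < T.ω ξ (J ξ)

namespace ComplexStructure

variable {T : Theory L A} (J : ComplexStructure T)

/-- The inner product `g(τ, ξ) = 2 ω(τ, J ξ)` on `L`. -/
def g : InnerForm L where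
  form := (2 : ℝ) • T.ω.compl₂ J.J
  symm x y := by
    have h : T.ω x (J.J y) = T.ω y (J.J x) := by
      rw [← J.symplectic x (J.J y), J.sq]
      simp [Theory.ω, symplecticForm]
      ring
    simp [h]
  pos x hx := by simpa using J.pos x hx

/-- `L` with the inner product `g`. -/
abbrev Space : Type _ := J.g.Space

def toSpace : L ≃ₗ[ℝ] J.Space := J.g.toSpace

/-- `g` makes `L` a separable Hilbert space for which `[·,·]` is continuous. -/
structure IsAdmissible : Prop where
  complete : CompleteSpace J.Space
  separable : TopologicalSpace.SeparableSpace J.Space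
  continuous_bracket : Continuous fun p : J.Space × J.Space =>
    T.bracket (J.toSpace.symm p.1) (J.toSpace.symm p.2)

/-- `J` and `Ω` correspond to each other: `Ω(φ, φ') = g(j φ, j φ') - i [j φ, φ']`, where
`j : Q → L` is the linear section of the quotient map with values in `J M`. -/
def Corresponds (Ω : VacuumForm T) : Prop :=
  ∃ j : T.Q →ₗ[ℝ] L, (∀ φ, T.q (j φ) = φ) ∧ (∀ φ, j φ ∈ T.M.map J.J) ∧
    ∀ φ φ', Ω.form φ φ' = (J.g.form (j φ) (j φ') : ℝ) - Complex.I * (T.bracketQ (j φ) φ' : ℝ)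

/-- The extension `L̂` of `L`. -/
abbrev LHat : Type _ := Extension J.Space

/-- The inclusion `L → L̂`. -/
def incl : L →ₗ[ℝ] J.LHat := Extension.incl J.Space ∘ₗ J.toSpace.toLinearMap

/-- The Gaussian measure on `L̂`, formally `exp (- g(ξ, ξ) / 2) dμ(ξ)`. -/
def νL : Measure J.LHat := gaussian J.Space 1

/-- The extension to `L̂` of the complex linear form `{σ, ·} = g(σ, ·) + 2 i ω(σ, ·)` on `(L, J)`.
Note that `2 ω(σ, ·) = g(J σ, ·)`. -/
def coord (σ : L) (x : J.LHat) : ℂ :=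
  (x (innerSL ℝ (J.toSpace σ)) : ℝ) + Complex.I * (x (innerSL ℝ (J.toSpace (J.J σ))) : ℝ)

theorem coord_incl (σ ξ : L) :
    J.coord σ (J.incl ξ) = (J.g.form σ ξ : ℝ) + 2 * Complex.I * (T.ω σ ξ : ℝ) := by
  have h1 : J.incl ξ (innerSL ℝ (J.toSpace σ)) = J.g.form σ ξ := rfl
  have h2 : J.incl ξ (innerSL ℝ (J.toSpace (J.J σ))) = 2 * T.ω (J.J σ) (J.J ξ) := rfl
  rw [coord, h1, h2, J.symplectic]
  push_cast
  ring

/-- Holomorphic cylinder functions on `L̂`: entire functions of finitely many continuous complex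
linear coordinates. -/
def IsHolCylinder (f : J.LHat → ℂ) : Prop :=
  ∃ (n : ℕ) (σ : Fin n → L) (p : (Fin n → ℂ) → ℂ), Differentiable ℂ p ∧
    ∀ x, f x = p fun i => J.coord (σ i) x

theorem IsHolCylinder.add {f f' : J.LHat → ℂ} (h : J.IsHolCylinder f) (h' : J.IsHolCylinder f') :
    J.IsHolCylinder (f + f') := by
  obtain ⟨n, σ, p, hp, hf⟩ := h
  obtain ⟨n', σ', p', hp', hf'⟩ := h'
  refine ⟨n + n', Fin.append σ σ',
    fun z => p (fun i => z (Fin.castAdd n' i)) + p' (fun i => z (Fin.natAdd n i)), ?_, fun x => ?_⟩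
  · exact (hp.comp (by fun_prop)).add (hp'.comp (by fun_prop))
  · simp [hf, hf']

theorem IsHolCylinder.smul {f : J.LHat → ℂ} (c : ℂ) (h : J.IsHolCylinder f) :
    J.IsHolCylinder (c • f) := by
  obtain ⟨n, σ, p, hp, hf⟩ := h
  exact ⟨n, σ, fun z => c * p z, by fun_prop, fun x => by simp [hf]⟩

/-- The Hilbert space `H²(L̂, ν_L)` of holomorphic square-integrable functions: the closure in
`L²(L̂, ν_L)` of the square-integrable holomorphic cylinder functions. -/
def H2 : Submodule ℂ (Lp ℂ 2 J.νL) :=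
  (Submodule.span ℂ {F : Lp ℂ 2 J.νL | ∃ f, J.IsHolCylinder f ∧ F =ᵐ[J.νL] f}).topologicalClosure

/-- `h` is the restriction to `L` of the holomorphic function `F` on `L̂`. (`L` may be a null set.
For a holomorphic cylinder function this is the ordinary restriction, and it extends to limits
in `L²` by pointwise convergence on `L`.) -/
def IsRestriction (F : Lp ℂ 2 J.νL) (h : L → ℂ) : Prop :=
  ∃ f : ℕ → J.LHat → ℂ, (∀ k, J.IsHolCylinder (f k)) ∧ (∀ k, MemLp (f k) 2 J.νL) ∧
    Tendsto (fun k => eLpNorm (f k - ⇑F) 2 J.νL) atTop (𝓝 0) ∧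
    ∀ ξ, Tendsto (fun k => f k (J.incl ξ)) atTop (𝓝 (h ξ))

/-- The function `α^η` on `A`. -/
def α (η ζ : A) : ℂ :=
  Complex.exp (Complex.I / 2 * (T.θ η (ζ -ᵥ η) : ℝ) + Complex.I / 2 * (T.θ ζ (ζ -ᵥ η) : ℝ)
    - 1 / 4 * (J.g.form (ζ -ᵥ η) (ζ -ᵥ η) : ℝ))

/-- The wave function on `A` of the holomorphic coherent state associated with `τ ∈ A`. -/
def coherent (τ : A) : A → ℂ := fun ζ =>
  Complex.exp (Complex.I / 2 * (T.θ τ (ζ -ᵥ τ) : ℝ) + Complex.I / 2 * (T.θ ζ (ζ -ᵥ τ) : ℝ)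
    - 1 / 4 * (J.g.form (ζ -ᵥ τ) (ζ -ᵥ τ) : ℝ))

/-- `F` represents the wave function `ψ` with respect to the base point `η`:
`ψ(ζ) = F(ζ - η) α^η(ζ)` for all `ζ ∈ A`. -/
def Represents (η : A) (ψ : A → ℂ) (F : Lp ℂ 2 J.νL) : Prop :=
  ∃ h : L → ℂ, J.IsRestriction F h ∧ ∀ ζ, ψ ζ = h (ζ -ᵥ η) * J.α η ζ

theorem Represents.add {η : A} {ψ ψ' : A → ℂ} {F F' : Lp ℂ 2 J.νL} (h : J.Represents η ψ F)
    (h' : J.Represents η ψ' F') : J.Represents η (ψ + ψ') (F + F') := by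
  obtain ⟨r, ⟨f, h1, h2, h3, h4⟩, hr⟩ := h
  obtain ⟨r', ⟨f', h1', h2', h3', h4'⟩, hr'⟩ := h'
  refine ⟨r + r', ⟨fun k => f k + f' k, fun k => (h1 k).add J (h1' k), fun k => (h2 k).add (h2' k),
    ?_, fun ξ => (h4 ξ).add (h4' ξ)⟩, fun ζ => by simp [hr, hr', add_mul]⟩
  refine tendsto_of_tendsto_of_tendsto_of_le_of_le tendsto_const_nhds
    (by simpa using h3.add h3') (fun _ => zero_le) fun k => ?_
  have : (f k + f' k - ⇑(F + F') : J.LHat → ℂ) =ᵐ[J.νL] (f k - ⇑F) + (f' k - ⇑F') := by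
    filter_upwards [Lp.coeFn_add F F'] with x hx
    simp only [Pi.sub_apply, Pi.add_apply, hx]
    ring
  rw [eLpNorm_congr_ae this]
  exact eLpNorm_add_le ((h2 k).1.sub (Lp.aestronglyMeasurable F))
    ((h2' k).1.sub (Lp.aestronglyMeasurable F')) (by norm_num)

theorem Represents.smul {η : A} {ψ : A → ℂ} {F : Lp ℂ 2 J.νL} (c : ℂ) (h : J.Represents η ψ F) :
    J.Represents η (c • ψ) (c • F) := by
  obtain ⟨r, ⟨f, h1, h2, h3, h4⟩, hr⟩ := h
  refine ⟨c • r, ⟨fun k => c • f k, fun k => (h1 k).smul J c, fun k => (h2 k).const_smul c,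
    ?_, fun ξ => (h4 ξ).const_smul c⟩, fun ζ => by simp [hr, mul_assoc]⟩
  have hc := ENNReal.Tendsto.const_mul (a := ‖c‖ₑ) h3 (Or.inr (by simp))
  rw [mul_zero] at hc
  refine hc.congr fun k => ?_
  have : (c • f k - ⇑(c • F) : J.LHat → ℂ) =ᵐ[J.νL] c • (f k - ⇑F) := by
    filter_upwards [Lp.coeFn_smul c F] with x hx
    simp only [Pi.sub_apply, Pi.smul_apply, hx, smul_sub]
  rw [eLpNorm_congr_ae this, eLpNorm_const_smul]

theorem represents_zero (η : A) : J.Represents η 0 0 := by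
  refine ⟨0, ⟨fun _ => 0, fun _ => ⟨0, Fin.elim0, 0, by fun_prop, fun _ => rfl⟩, fun _ => .zero,
    ?_, fun _ => tendsto_const_nhds⟩, fun _ => by simp⟩
  have : (0 - ⇑(0 : Lp ℂ 2 J.νL) : J.LHat → ℂ) =ᵐ[J.νL] 0 := by
    filter_upwards [Lp.coeFn_zero ℂ 2 J.νL] with x hx
    rw [Pi.sub_apply, hx]; simp
  simp only [eLpNorm_congr_ae this, eLpNorm_zero]
  exact tendsto_const_nhds

/-- The space of states of the holomorphic representation. It consists of the functions `ψ` on `A`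
such that for each base point `η` the function `ψ / α^η`, viewed as a function on `L`, is the
restriction to `L` of a holomorphic square-integrable function on `L̂`. -/
def stateSpace : Submodule ℂ (A → ℂ) where
  carrier := {ψ | ∀ η, ∃ F ∈ J.H2, J.Represents η ψ F}
  add_mem' h h' η := by
    obtain ⟨F, hF, hψ⟩ := h η
    obtain ⟨F', hF', hψ'⟩ := h' η
    exact ⟨F + F', add_mem hF hF', hψ.add J hψ'⟩
  zero_mem' η := ⟨0, zero_mem _, J.represents_zero η⟩
  smul_mem' c ψ h η := by
    obtain ⟨F, hF, hψ⟩ := h η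
    exact ⟨c • F, J.H2.smul_mem c hF, hψ.smul J c⟩

end ComplexStructure

end AffineFieldTheory

end

open AffineFieldTheory

/-!
The Riesz isomorphism of `(Q, Re Ω)` assigns to `ξ ∈ L` a momentum `p ξ ∈ Q` with
`Re Ω(p ξ, ·) = [ξ, ·] + Im Ω(q ξ, ·)`, and `ξ ↦ (p ξ, q ξ)` identifies `L` with `Q × Q` in such a
way that `2 ω` becomes `Re Ω(p, q') - Re Ω(p', q)`. The complex structure corresponding to `Ω` can
then only be the one with `q J = p` and `p J = -q`.

For every base point `η`, the reduced coherent states in `L²(Q̂, ν_Q)` and in `H²(L̂, ν_L)` have the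
same Gram matrix `⟪K_ζ, K_ζ'⟫ = K_ζ' (ζ)`, where `K_τ` is the holomorphic coherent state, so
totality of both families gives a unitary map matching them up; as the Gram matrix does not involve
`η`, neither does the result. In the Schrödinger representation totality is Fourier uniqueness,
since the coherent states of `τ ∈ η + M` are characters up to a factor. In the holomorphic
representation a state is recovered from its wave function by `ψ(ζ) = ⟪K_ζ, ψ⟫`. This reproducing
property is the mean value property of holomorphic functions over the rotations `exp (t J)`,
transported to all points of `L` by Cameron–Martin translation. Totality follows because a cylinder
function depends on a finite-dimensional `J`-invariant space of coordinates, on which it is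
determined by its values on `L`.
-/

noncomputable section

namespace AffineFieldTheory

open scoped ComplexConjugate

/-! ### Total families -/

section TotalFamilies

variable {𝕜 ι H K : Type*} [RCLike 𝕜] [NormedAddCommGroup H] [InnerProductSpace 𝕜 H]
  [NormedAddCommGroup K] [InnerProductSpace 𝕜 K]

/-- A family of vectors is total if its linear span is dense. -/
def IsTotalFamily (𝕜 : Type*) {ι H : Type*} [RCLike 𝕜] [NormedAddCommGroup H]
    [InnerProductSpace 𝕜 H] (c : ι → H) : Prop :=
  DenseRange (Finsupp.linearCombination 𝕜 c)

theorem isTotalFamily_iff_topologicalClosure_span {c : ι → H} :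
    IsTotalFamily 𝕜 c ↔ (Submodule.span 𝕜 (Set.range c)).topologicalClosure = ⊤ := by
  rw [← Finsupp.range_linearCombination, ← Submodule.dense_iff_topologicalClosure_eq_top]
  rfl

theorem isTotalFamily_of_forall_inner_eq_zero [CompleteSpace H] {c : ι → H}
    (h : ∀ x, (∀ i, inner 𝕜 (c i) x = 0) → x = 0) : IsTotalFamily 𝕜 c := by
  rw [isTotalFamily_iff_topologicalClosure_span, Submodule.topologicalClosure_eq_top_iff,
    Submodule.eq_bot_iff]
  exact fun x hx => h x fun i =>
    (Submodule.mem_orthogonal _ _).1 hx _ (Submodule.subset_span (Set.mem_range_self i))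

/-- The linear map sending a vector to its coefficients `⟪c i, x⟫` with respect to a family `c`;
for the coherent states this is the passage from a vector to its wave function. -/
def coefficients (𝕜 : Type*) {ι H : Type*} [RCLike 𝕜] [NormedAddCommGroup H]
    [InnerProductSpace 𝕜 H] (c : ι → H) : H →ₗ[𝕜] ι → 𝕜 :=
  LinearMap.pi fun i => (innerSL 𝕜 (c i)).toLinearMap

theorem coefficients_apply (c : ι → H) (x : H) (i : ι) :
    coefficients 𝕜 c x i = inner 𝕜 (c i) x := rfl

theorem IsTotalFamily.coefficients_injective {c : ι → H} (hc : IsTotalFamily 𝕜 c) :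
    Function.Injective (coefficients 𝕜 c) := fun x y h => by
  refine DenseRange.eq_of_inner_right 𝕜 hc fun a => ?_
  have hi : ∀ i, inner 𝕜 (c i) x = inner 𝕜 (c i) y := congrFun h
  simp only [Finsupp.linearCombination_apply, Finsupp.sum, sum_inner, inner_smul_left, hi]

variable {c : ι → H} {d : ι → K}

theorem inner_linearCombination_eq (hcd : ∀ i j, inner 𝕜 (c i) (c j) = inner 𝕜 (d i) (d j))
    (a b : ι →₀ 𝕜) :
    inner 𝕜 (Finsupp.linearCombination 𝕜 c a) (Finsupp.linearCombination 𝕜 c b) =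
      inner 𝕜 (Finsupp.linearCombination 𝕜 d a) (Finsupp.linearCombination 𝕜 d b) := by
  simp only [Finsupp.linearCombination_apply, Finsupp.sum, sum_inner, inner_sum, inner_smul_left,
    inner_smul_right, hcd]

theorem norm_linearCombination_eq (hcd : ∀ i j, inner 𝕜 (c i) (c j) = inner 𝕜 (d i) (d j))
    (a : ι →₀ 𝕜) :
    ‖Finsupp.linearCombination 𝕜 c a‖ = ‖Finsupp.linearCombination 𝕜 d a‖ := by
  rw [norm_eq_sqrt_re_inner (𝕜 := 𝕜), inner_linearCombination_eq hcd,
    ← norm_eq_sqrt_re_inner]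

variable [CompleteSpace H] [CompleteSpace K]

/-- The unitary map carrying a total family to another one with the same Gram matrix. -/
def IsTotalFamily.unitary (hc : IsTotalFamily 𝕜 c) (hd : IsTotalFamily 𝕜 d)
    (hcd : ∀ i j, inner 𝕜 (c i) (c j) = inner 𝕜 (d i) (d j)) : H ≃ₗᵢ[𝕜] K :=
  (LinearEquiv.refl 𝕜 (ι →₀ 𝕜)).extendOfIsometry (Finsupp.linearCombination 𝕜 c)
    (Finsupp.linearCombination 𝕜 d) hc hd fun a => (norm_linearCombination_eq hcd a).symm

theorem IsTotalFamily.unitary_apply (hc : IsTotalFamily 𝕜 c) (hd : IsTotalFamily 𝕜 d)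
    (hcd : ∀ i j, inner 𝕜 (c i) (c j) = inner 𝕜 (d i) (d j)) (i : ι) :
    hc.unitary hd hcd (c i) = d i := by
  simpa [unitary] using LinearEquiv.extendOfIsometry_eq (LinearEquiv.refl 𝕜 (ι →₀ 𝕜)) _ _ hc hd
    (fun a => (norm_linearCombination_eq hcd a).symm) (Finsupp.single i 1)

theorem IsTotalFamily.coefficients_unitary (hc : IsTotalFamily 𝕜 c) (hd : IsTotalFamily 𝕜 d)
    (hcd : ∀ i j, inner 𝕜 (c i) (c j) = inner 𝕜 (d i) (d j)) (x : H) :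
    coefficients 𝕜 d (hc.unitary hd hcd x) = coefficients 𝕜 c x := by
  ext i
  rw [coefficients_apply, coefficients_apply, ← hc.unitary_apply hd hcd,
    LinearIsometryEquiv.inner_map_map]

theorem IsTotalFamily.range_coefficients_eq (hc : IsTotalFamily 𝕜 c) (hd : IsTotalFamily 𝕜 d)
    (hcd : ∀ i j, inner 𝕜 (c i) (c j) = inner 𝕜 (d i) (d j)) :
    LinearMap.range (coefficients 𝕜 c) = LinearMap.range (coefficients 𝕜 d) := by
  apply le_antisymm
  · rintro _ ⟨x, rfl⟩
    exact ⟨_, hc.coefficients_unitary hd hcd x⟩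
  · rintro _ ⟨y, rfl⟩
    exact ⟨_, hd.coefficients_unitary hc (fun i j => (hcd i j).symm) y⟩

theorem IsTotalFamily.norm_eq_of_coefficients_eq (hc : IsTotalFamily 𝕜 c)
    (hd : IsTotalFamily 𝕜 d) (hcd : ∀ i j, inner 𝕜 (c i) (c j) = inner 𝕜 (d i) (d j))
    {x : H} {y : K} (h : coefficients 𝕜 c x = coefficients 𝕜 d y) : ‖x‖ = ‖y‖ := by
  rw [← hd.coefficients_injective ((hc.coefficients_unitary hd hcd x).trans h),
    LinearIsometryEquiv.norm_map]

end TotalFamilies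

/-! ### Separating families of functions -/

section SeparatingFamilies

variable {X ι : Type*} [MeasurableSpace X]

/-- A family of functions separates finite measures if a finite measure is determined by the
integrals of the members of the family. -/
def SeparatesFiniteMeasures (g : ι → X → ℂ) : Prop :=
  ∀ ⦃μ μ' : Measure X⦄ [IsFiniteMeasure μ] [IsFiniteMeasure μ'],
    (∀ i, ∫ x, g i x ∂μ = ∫ x, g i x ∂μ') → μ = μ'

theorem integral_withDensity_ofReal {μ : Measure X} {u : X → ℝ} (hu : AEMeasurable u μ)
    (g : X → ℂ) :
    ∫ x, g x ∂(μ.withDensity fun x => ENNReal.ofReal (u x)) = ∫ x, g x * (max (u x) 0 : ℝ) ∂μ := by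
  rw [integral_withDensity_eq_integral_toReal_smul₀ hu.ennreal_ofReal
    (ae_of_all _ fun _ => ENNReal.ofReal_lt_top)]
  simp only [ENNReal.toReal_ofReal', Complex.real_smul, mul_comm]

theorem ae_eq_zero_of_withDensity_ofReal_eq {μ : Measure X} {f : X → ℝ} (hf : Integrable f μ)
    (h : (μ.withDensity fun x => ENNReal.ofReal (f x)) =
      μ.withDensity fun x => ENNReal.ofReal ((-f) x)) : f =ᵐ[μ] 0 := by
  have hae := (withDensity_eq_iff hf.aemeasurable.ennreal_ofReal
    hf.aemeasurable.neg.ennreal_ofReal hf.lintegral_lt_top.ne).1 h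
  filter_upwards [hae] with x hx
  have hx' := congrArg ENNReal.toReal hx
  simp only [ENNReal.toReal_ofReal', Pi.neg_apply] at hx'
  rw [Pi.zero_apply, ← max_zero_sub_max_neg_zero_eq_self (f x), hx', sub_self]

variable {μ : Measure X} {g : ι → X → ℂ}

theorem SeparatesFiniteMeasures.ae_eq_zero_of_integral_mul_ofReal (hg : SeparatesFiniteMeasures g)
    (hgm : ∀ i, Measurable (g i)) (hgb : ∀ i, ∃ C, ∀ x, ‖g i x‖ ≤ C) {f : X → ℝ}
    (hf : Integrable f μ) (h : ∀ i, ∫ x, g i x * (f x : ℂ) ∂μ = 0) : f =ᵐ[μ] 0 := by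
  have hint : ∀ i {u : X → ℝ}, Integrable u μ → Integrable (fun x => g i x * (u x : ℂ)) μ := by
    intro i u hu
    obtain ⟨C, hC⟩ := hgb i
    exact hu.ofReal.bdd_mul (hgm i).aestronglyMeasurable (ae_of_all _ hC)
  have := isFiniteMeasure_withDensity_ofReal hf.2
  have := isFiniteMeasure_withDensity_ofReal hf.neg.2
  refine ae_eq_zero_of_withDensity_ofReal_eq hf (hg fun i => ?_)
  rw [integral_withDensity_ofReal hf.aemeasurable, integral_withDensity_ofReal hf.aemeasurable.neg,
    ← sub_eq_zero, ← integral_sub (hint i hf.pos_part) (hint i hf.neg.pos_part), ← h i]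
  simp only [Pi.neg_apply, ← mul_sub, ← Complex.ofReal_sub, max_zero_sub_max_neg_zero_eq_self]

theorem SeparatesFiniteMeasures.ae_eq_zero_of_integral_mul (hg : SeparatesFiniteMeasures g)
    (hgm : ∀ i, Measurable (g i)) (hgb : ∀ i, ∃ C, ∀ x, ‖g i x‖ ≤ C)
    (hgc : ∀ i, ∃ j, ∀ x, g j x = conj (g i x)) {f : X → ℂ} (hf : Integrable f μ)
    (h : ∀ i, ∫ x, g i x * f x ∂μ = 0) : f =ᵐ[μ] 0 := by
  have hint : ∀ i {u : X → ℂ}, Integrable u μ → Integrable (fun x => g i x * u x) μ := by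
    intro i u hu
    obtain ⟨C, hC⟩ := hgb i
    exact hu.bdd_mul (hgm i).aestronglyMeasurable (ae_of_all _ hC)
  have hfc : Integrable (fun x => conj (f x)) μ :=
    Complex.conjCLE.toContinuousLinearMap.integrable_comp hf
  have hc : ∀ i, ∫ x, g i x * conj (f x) ∂μ = 0 := by
    intro i
    obtain ⟨j, hj⟩ := hgc i
    have hj0 := congrArg conj (h j)
    rw [← integral_conj, map_zero] at hj0
    simpa only [hj, map_mul, Complex.conj_conj] using hj0
  have hre : (fun x => (f x).re) =ᵐ[μ] 0 :=
    hg.ae_eq_zero_of_integral_mul_ofReal hgm hgb hf.re fun i => by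
      simp only [Complex.re_eq_add_conj, mul_div_assoc', mul_add]
      rw [integral_div, integral_add (hint i hf) (hint i hfc), h, hc, add_zero, zero_div]
  have him : (fun x => (f x).im) =ᵐ[μ] 0 :=
    hg.ae_eq_zero_of_integral_mul_ofReal hgm hgb hf.im fun i => by
      simp only [Complex.im_eq_sub_conj, mul_div_assoc', mul_sub]
      rw [integral_div, integral_sub (hint i hf) (hint i hfc), h, hc, sub_zero, zero_div]
  filter_upwards [hre, him] with x h1 h2
  exact Complex.ext h1 h2

end SeparatingFamilies

/-! ### Gaussian calculus -/

section GaussianCalculus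

variable {E : Type*} [NormedAddCommGroup E] [InnerProductSpace ℝ E]

namespace Extension

@[fun_prop]
theorem measurable_apply (ℓ : StrongDual ℝ E) : Measurable fun x : Extension E => x ℓ :=
  measurable_extension_apply ℓ

theorem measurable_of_apply {α : Type*} [MeasurableSpace α] {f : α → Extension E}
    (h : ∀ ℓ : StrongDual ℝ E, Measurable fun a => f a ℓ) : Measurable f := by
  rw [measurable_comap_iff, measurable_pi_iff]
  exact h

theorem measurable_add_const (y : Extension E) : Measurable fun x : Extension E => x + y :=
  measurable_of_apply fun ℓ => (measurable_apply ℓ).add_const (y ℓ)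

theorem exists_apply_eq_comp_restrict (I : Finset (StrongDual ℝ E)) (u : StrongDual ℝ (I → ℝ)) :
    ∃ ℓ : StrongDual ℝ E, ∀ x : Extension E, u (fun k : I => x k) = x ℓ := by
  classical
  refine ⟨∑ k : I, u (Pi.single k 1) • (k : StrongDual ℝ E), fun x => ?_⟩
  conv_lhs => rw [← Finset.univ_sum_single (fun k : I => x k)]
  simp only [map_sum, map_smul, smul_eq_mul]
  refine Finset.sum_congr rfl fun k _ => ?_
  rw [← mul_one (x k), ← smul_eq_mul, Pi.single_smul, map_smul, smul_eq_mul, smul_eq_mul, mul_one,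
    mul_comm]

theorem ext_of_map_restrict {μ μ' : Measure (Extension E)} [IsFiniteMeasure μ] [IsFiniteMeasure μ']
    (h : ∀ I : Finset (StrongDual ℝ E),
      μ.map (fun x (k : I) => x (k : StrongDual ℝ E)) = μ'.map fun x (k : I) => x k) :
    μ = μ' := by
  have hi : Measurable fun (x : Extension E) (ℓ : StrongDual ℝ E) => x ℓ := comap_measurable _
  have hmap : μ.map (fun x ℓ => x ℓ) = μ'.map (fun x ℓ => x ℓ) := by
    refine IsProjectiveLimit.unique (P := fun I => μ.map fun x (k : I) => x k)
      (fun I => Measure.map_map (Finset.measurable_restrict I) hi) fun I => ?_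
    exact (Measure.map_map (Finset.measurable_restrict I) hi).trans (h I).symm
  ext s hs
  obtain ⟨t, ht, rfl⟩ := hs
  simpa only [Measure.map_apply hi ht] using congrArg (fun m => m t) hmap

/-- The unitary character of the extension given by a continuous linear form; the integrals of the
characters form the characteristic functional of a measure. -/
def character (ℓ : StrongDual ℝ E) (x : Extension E) : ℂ :=
  Complex.exp ((x ℓ : ℝ) * Complex.I)

theorem measurable_character (ℓ : StrongDual ℝ E) : Measurable (character ℓ) := by
  unfold character
  fun_prop

theorem norm_character (ℓ : StrongDual ℝ E) (x : Extension E) : ‖character ℓ x‖ = 1 :=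
  Complex.norm_exp_ofReal_mul_I _

theorem character_neg (ℓ : StrongDual ℝ E) (x : Extension E) :
    character (-ℓ) x = conj (character ℓ x) := by
  simp [character, ← Complex.exp_conj]

theorem separatesFiniteMeasures_character :
    SeparatesFiniteMeasures (character : StrongDual ℝ E → Extension E → ℂ) := by
  intro μ μ' _ _ h
  refine ext_of_map_restrict fun I => ?_
  have hm : Measurable fun (x : Extension E) (k : I) => x (k : StrongDual ℝ E) :=
    measurable_pi_iff.2 fun k => measurable_apply (k : StrongDual ℝ E)
  have hc (u : StrongDual ℝ (I → ℝ)) :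
      Continuous fun y => Complex.exp ((u y : ℂ) * Complex.I) := by fun_prop
  refine Measure.ext_of_charFunDual (funext fun u => ?_)
  obtain ⟨ℓ, hℓ⟩ := exists_apply_eq_comp_restrict I u
  rw [charFunDual_apply, charFunDual_apply,
    integral_map hm.aemeasurable (hc u).aestronglyMeasurable,
    integral_map hm.aemeasurable (hc u).aestronglyMeasurable]
  simp only [hℓ]
  exact h ℓ

theorem ae_eq_zero_of_integral_character_mul {ν : Measure (Extension E)} {f : Extension E → ℂ}
    (hf : Integrable f ν) (h : ∀ ℓ, ∫ x, character ℓ x * f x ∂ν = 0) : f =ᵐ[ν] 0 :=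
  separatesFiniteMeasures_character.ae_eq_zero_of_integral_mul measurable_character
    (fun ℓ => ⟨1, fun x => (norm_character ℓ x).le⟩) (fun ℓ => ⟨-ℓ, character_neg ℓ⟩) hf h

end Extension

open AffineFieldTheory.Extension (character incl)

/-- The density `exp (-⟪e, x⟫ / v - ‖e‖² / (2 v))` by which the centered Gaussian measure of
variance `v` has to be multiplied so that the translation by `e` carries it back to the Gaussian
measure (the Cameron–Martin formula). -/
def cameronMartinDensity (v : ℝ≥0) (e : E) (x : Extension E) : ℝ :=
  Real.exp (-x (innerSL ℝ e) / v - inner ℝ e e / (2 * v))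

theorem cameronMartinDensity_pos (v : ℝ≥0) (e : E) (x : Extension E) :
    0 < cameronMartinDensity v e x :=
  Real.exp_pos _

@[fun_prop]
theorem measurable_cameronMartinDensity (v : ℝ≥0) (e : E) :
    Measurable (cameronMartinDensity v e) := by
  unfold cameronMartinDensity
  fun_prop

namespace IsCanonicalGaussian

variable {v : ℝ≥0} {ν : Measure (Extension E)}

theorem integrable_exp (hν : IsCanonicalGaussian v ν) (ℓ : StrongDual ℝ E) :
    Integrable (fun x => Real.exp (x ℓ)) ν := by
  have h := integrable_exp_mul_gaussianReal (μ := 0) (v := v * ‖ℓ‖₊ ^ 2) 1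
  rw [← hν ℓ] at h
  simpa only [Function.comp_def, one_mul] using h.comp_measurable (measurable_extension_apply ℓ)

theorem memLp_cexp (hν : IsCanonicalGaussian v ν) (a b : E) (z w : ℂ) :
    MemLp (fun x => Complex.exp (z * (x (innerSL ℝ a) : ℝ) + w * (x (innerSL ℝ b) : ℝ))) 2 ν := by
  have hm : Measurable fun x : Extension E =>
    Complex.exp (z * (x (innerSL ℝ a) : ℝ) + w * (x (innerSL ℝ b) : ℝ)) := by fun_prop
  rw [memLp_two_iff_integrable_sq_norm hm.aestronglyMeasurable]
  convert! hν.integrable_exp (innerSL ℝ ((2 * z.re) • a + (2 * w.re) • b)) using 2 with x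
  rw [Complex.norm_exp, ← Real.exp_nat_mul]
  simp
  ring

theorem integral_cexp_mul (hν : IsCanonicalGaussian v ν) (ℓ : StrongDual ℝ E) (z : ℂ) :
    ∫ x, Complex.exp (z * (x ℓ : ℝ)) ∂ν = Complex.exp ((v : ℂ) / 2 * (‖ℓ‖ : ℂ) ^ 2 * z ^ 2) := by
  have h := complexMGF_gaussianReal (hν ℓ) z
  rw [complexMGF] at h
  rw [h]
  congr 1
  push_cast
  ring

theorem charFunDual_map (hν : IsCanonicalGaussian v ν) {F : Type*} [NormedAddCommGroup F]
    [NormedSpace ℝ F] [MeasurableSpace F] [BorelSpace F] {f : Extension E → F}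
    (hf : Measurable f) {u : StrongDual ℝ F} {ℓ : StrongDual ℝ E} (h : ∀ x, u (f x) = x ℓ) :
    charFunDual (ν.map f) u = Complex.exp (-((v : ℂ) / 2 * (‖ℓ‖ : ℂ) ^ 2)) := by
  rw [charFunDual_apply, integral_map hf.aemeasurable
    (by exact Measurable.aestronglyMeasurable (by fun_prop))]
  simp only [h, mul_comm _ Complex.I]
  rw [hν.integral_cexp_mul, Complex.I_sq, mul_neg_one]

theorem indepFun (hν : IsCanonicalGaussian v ν) {a b : E} (hab : inner ℝ a b = 0) :
    IndepFun (fun x : Extension E => x (innerSL ℝ a)) (fun x => x (innerSL ℝ b)) ν := by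
  have := hν.isProbabilityMeasure
  have ha := measurable_extension_apply (innerSL ℝ a)
  have hb := measurable_extension_apply (innerSL ℝ b)
  rw [indepFun_iff_charFunDual_prod ha.aemeasurable hb.aemeasurable]
  intro u
  have hu (s t : ℝ) : u (s, t) = s * u (1, 0) + t * u (0, 1) := by
    rw [← smul_eq_mul, ← smul_eq_mul, ← map_smul, ← map_smul, ← map_add]
    simp
  rw [hν.charFunDual_map (ha.prodMk hb) (ℓ := innerSL ℝ (u (1, 0) • a + u (0, 1) • b)) fun x => by
      rw [hu]; simp [mul_comm],
    hν.charFunDual_map ha (ℓ := innerSL ℝ (u (1, 0) • a)) fun x => by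
      simp [hu (x (innerSL ℝ a)) 0, mul_comm],
    hν.charFunDual_map hb (ℓ := innerSL ℝ (u (0, 1) • b)) fun x => by
      simp [hu 0 (x (innerSL ℝ b)), mul_comm],
    ← Complex.exp_add]
  have hnorm : ‖u (1, 0) • a + u (0, 1) • b‖ ^ 2 = ‖u (1, 0) • a‖ ^ 2 + ‖u (0, 1) • b‖ ^ 2 := by
    rw [norm_add_sq_real, inner_smul_left, inner_smul_right, hab]
    simp
  simp only [innerSL_apply_norm, ← Complex.ofReal_pow, hnorm]
  push_cast
  ring_nf

theorem integral_cexp_of_inner_eq_zero (hν : IsCanonicalGaussian v ν) {a b : E}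
    (hab : inner ℝ a b = 0) (z w : ℂ) :
    ∫ x, Complex.exp (z * (x (innerSL ℝ a) : ℝ) + w * (x (innerSL ℝ b) : ℝ)) ∂ν =
      Complex.exp ((v : ℂ) / 2 * (z ^ 2 * (inner ℝ a a : ℝ) + w ^ 2 * (inner ℝ b b : ℝ))) := by
  have hc (z : ℂ) : Continuous fun s : ℝ => Complex.exp (z * s) := by fun_prop
  simp only [Complex.exp_add]
  refine ((hν.indepFun hab).integral_fun_comp_mul_comp (𝕜 := ℂ)
    (measurable_extension_apply _).aemeasurable (measurable_extension_apply _).aemeasurable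
    (hc z).aestronglyMeasurable (hc w).aestronglyMeasurable).trans ?_
  rw [hν.integral_cexp_mul, hν.integral_cexp_mul, ← Complex.exp_add, innerSL_apply_norm,
    innerSL_apply_norm, real_inner_self_eq_norm_sq, real_inner_self_eq_norm_sq]
  push_cast
  ring_nf

theorem integral_cexp (hν : IsCanonicalGaussian v ν) (a b : E) (z w : ℂ) :
    ∫ x, Complex.exp (z * (x (innerSL ℝ a) : ℝ) + w * (x (innerSL ℝ b) : ℝ)) ∂ν =
      Complex.exp ((v : ℂ) / 2 * (z ^ 2 * (inner ℝ a a : ℝ) + 2 * z * w * (inner ℝ a b : ℝ)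
        + w ^ 2 * (inner ℝ b b : ℝ))) := by
  obtain ⟨c, b', hab', rfl⟩ : ∃ (c : ℝ) (b' : E), inner ℝ a b' = 0 ∧ b = c • a + b' := by
    refine ⟨inner ℝ a b / inner ℝ a a, b - (inner ℝ a b / inner ℝ a a) • a, ?_, by abel⟩
    rcases eq_or_ne a 0 with rfl | ha
    · simp
    · rw [inner_sub_right, inner_smul_right, div_mul_cancel₀ _ (inner_self_ne_zero.2 ha), sub_self]
  have h := hν.integral_cexp_of_inner_eq_zero hab' (z + w * c) w
  have hba : inner ℝ b' a = 0 := by rw [real_inner_comm, hab']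
  have e1 : inner ℝ a (c • a + b') = c * inner ℝ a a := by
    rw [inner_add_right, inner_smul_right, hab', add_zero]
  have e2 : inner ℝ (c • a + b') (c • a + b') = c ^ 2 * inner ℝ a a + inner ℝ b' b' := by
    rw [inner_add_left, inner_smul_left, e1, inner_add_right, inner_smul_right, hba]
    simp
    ring
  calc _ = ∫ x : Extension E, Complex.exp ((z + w * c) * (x (innerSL ℝ a) : ℝ)
        + w * (x (innerSL ℝ b') : ℝ)) ∂ν := by
        refine integral_congr_ae (ae_of_all _ fun x => congrArg Complex.exp ?_)
        simp
        ring
    _ = _ := by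
        rw [h, e1, e2]
        push_cast
        ring_nf

theorem integrable_cameronMartinDensity (hν : IsCanonicalGaussian v ν) (e : E) :
    Integrable (cameronMartinDensity v e) ν := by
  convert! (hν.integrable_exp ((-1 / v : ℝ) • innerSL ℝ e)).mul_const
    (Real.exp (-(inner ℝ e e / (2 * v)))) using 2 with x
  rw [cameronMartinDensity, ← Real.exp_add, map_smul, smul_eq_mul]
  ring_nf

theorem integral_cameronMartinDensity_mul_character (hν : IsCanonicalGaussian v ν) (hv : v ≠ 0)
    (e l : E) :
    ∫ x, (cameronMartinDensity v e x : ℂ) * character (innerSL ℝ l) (x + incl E e) ∂ν =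
      ∫ x, character (innerSL ℝ l) x ∂ν := by
  have hv' : (v : ℂ) ≠ 0 := by exact_mod_cast hv
  have hie : incl E e (innerSL ℝ l) = inner ℝ l e := rfl
  have hsplit (x : Extension E) :
      (cameronMartinDensity v e x : ℂ) * character (innerSL ℝ l) (x + incl E e) =
        Complex.exp (Complex.I * (inner ℝ l e : ℝ) - (inner ℝ e e : ℝ) / (2 * v)) *
          Complex.exp (-1 / v * (x (innerSL ℝ e) : ℝ) + Complex.I * (x (innerSL ℝ l) : ℝ)) := by
    rw [cameronMartinDensity, character, LinearMap.add_apply, hie, Complex.ofReal_exp,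
      ← Complex.exp_add, ← Complex.exp_add]
    push_cast
    ring_nf
  simp only [hsplit]
  simp only [character, mul_comm _ Complex.I]
  rw [integral_const_mul, hν.integral_cexp, hν.integral_cexp_mul, ← Complex.exp_add,
    innerSL_apply_norm, ← Complex.ofReal_pow, ← real_inner_self_eq_norm_sq l, real_inner_comm e l]
  congr 1
  field_simp
  ring

variable [CompleteSpace E]

theorem measurePreserving_add_incl (hν : IsCanonicalGaussian v ν) (hv : v ≠ 0) (e : E) :
    MeasurePreserving (fun x : Extension E => x + incl E e)
      (ν.withDensity fun x => ENNReal.ofReal (cameronMartinDensity v e x)) ν := by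
  have := hν.isProbabilityMeasure
  have := isFiniteMeasure_withDensity_ofReal (hν.integrable_cameronMartinDensity e).2
  have hT := Extension.measurable_add_const (incl E e)
  refine ⟨hT, Extension.separatesFiniteMeasures_character fun ℓ => ?_⟩
  obtain ⟨l, rfl⟩ : ∃ l, innerSL ℝ l = ℓ := (InnerProductSpace.toDual ℝ E).surjective ℓ
  rw [integral_map hT.aemeasurable (Extension.measurable_character _).aestronglyMeasurable,
    integral_withDensity_ofReal (measurable_cameronMartinDensity v e).aemeasurable,
    ← hν.integral_cameronMartinDensity_mul_character hv e l]
  simp only [max_eq_left (cameronMartinDensity_pos v e _).le, mul_comm]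

theorem quasiMeasurePreserving_add_incl (hν : IsCanonicalGaussian v ν) (hv : v ≠ 0) (e : E) :
    Measure.QuasiMeasurePreserving (fun x : Extension E => x + incl E e) ν ν := by
  refine (hν.measurePreserving_add_incl hv e).quasiMeasurePreserving.mono_left
    (withDensity_absolutelyContinuous' (Measurable.aemeasurable (by fun_prop)) ?_)
  exact ae_of_all _ fun x => by simp [cameronMartinDensity_pos]

theorem integrable_cameronMartinDensity_mul (hν : IsCanonicalGaussian v ν) (hv : v ≠ 0) (e : E)
    {f : Extension E → ℂ} (hf : Integrable f ν) :
    Integrable (fun x => (cameronMartinDensity v e x : ℂ) * f (x + incl E e)) ν := by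
  have h := (hν.measurePreserving_add_incl hv e).integrable_comp_of_integrable hf
  rw [integrable_withDensity_iff_integrable_smul' (by fun_prop)
    (ae_of_all _ fun _ => ENNReal.ofReal_lt_top)] at h
  simpa only [ENNReal.toReal_ofReal (cameronMartinDensity_pos v e _).le, Complex.real_smul,
    Function.comp_apply] using h

theorem integral_cameronMartinDensity_mul (hν : IsCanonicalGaussian v ν) (hv : v ≠ 0) (e : E)
    {f : Extension E → ℂ} (hf : AEStronglyMeasurable f ν) :
    ∫ x, (cameronMartinDensity v e x : ℂ) * f (x + incl E e) ∂ν = ∫ x, f x ∂ν := by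
  have hp := hν.measurePreserving_add_incl hv e
  have hf' := hf
  rw [← hp.map_eq] at hf'
  conv_rhs => rw [← hp.map_eq]
  rw [integral_map hp.measurable.aemeasurable hf',
    integral_withDensity_ofReal (measurable_cameronMartinDensity v e).aemeasurable]
  simp only [max_eq_left (cameronMartinDensity_pos v e _).le, mul_comm]

theorem lintegral_cameronMartinDensity_mul (hν : IsCanonicalGaussian v ν) (hv : v ≠ 0) (e : E)
    {f : Extension E → ℝ≥0∞} (hf : AEMeasurable f ν) :
    ∫⁻ x, ENNReal.ofReal (cameronMartinDensity v e x) * f (x + incl E e) ∂ν = ∫⁻ x, f x ∂ν := by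
  have hp := hν.measurePreserving_add_incl hv e
  have hf' := hf
  rw [← hp.map_eq] at hf'
  conv_rhs => rw [← hp.map_eq]
  rw [lintegral_map' hf' hp.measurable.aemeasurable]
  exact (lintegral_withDensity_eq_lintegral_mul₀' (Measurable.aemeasurable (by fun_prop))
    (hf'.comp_aemeasurable hp.measurable.aemeasurable)).symm

theorem eLpNorm_translate_mul (hν : IsCanonicalGaussian v ν) (hv : v ≠ 0) (e : E)
    {f K : Extension E → ℂ} (hf : AEStronglyMeasurable f ν)
    (hK : ∀ x, ‖K x‖ ^ 2 = cameronMartinDensity v e x) :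
    eLpNorm (fun x => f (x + incl E e) * K x) 2 ν = eLpNorm f 2 ν := by
  rw [eLpNorm_eq_lintegral_rpow_enorm_toReal (by norm_num) (by norm_num),
    eLpNorm_eq_lintegral_rpow_enorm_toReal (by norm_num) (by norm_num),
    ← hν.lintegral_cameronMartinDensity_mul hv e (hf.enorm.pow_const _)]
  congr 1
  refine lintegral_congr fun x => ?_
  rw [← hK]
  simp [mul_pow, mul_comm]

end IsCanonicalGaussian

end GaussianCalculus

/-! ### The complex structure of a vacuum -/

variable {L A : Type*} [AddCommGroup L] [Module ℝ L] [AddTorsor L A]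

namespace Theory

variable (T : Theory L A)

theorem θ_eq (η η' : A) (ξ : L) : T.θ η' ξ = T.θ η ξ + T.bracket (η' -ᵥ η) ξ := by
  simpa only [vsub_vadd] using T.equivariant η (η' -ᵥ η) ξ

theorem bracketQ_q (ξ τ : L) : T.bracketQ ξ (T.q τ) = T.bracket ξ τ := rfl

theorem ω_apply (ξ τ : L) :
    T.ω ξ τ = 1 / 2 * (T.bracketQ ξ (T.q τ) - T.bracketQ τ (T.q ξ)) := rfl

theorem q_eq_zero_iff {ξ : L} : T.q ξ = 0 ↔ ξ ∈ T.M :=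
  Submodule.Quotient.mk_eq_zero _

theorem q_surjective : Function.Surjective T.q :=
  Submodule.mkQ_surjective _

theorem bracketQ_add (ξ τ : L) (φ : T.Q) :
    T.bracketQ (ξ + τ) φ = T.bracketQ ξ φ + T.bracketQ τ φ := by
  obtain ⟨σ, rfl⟩ := T.q_surjective φ
  simp only [bracketQ_q, map_add, LinearMap.add_apply]

theorem bracketQ_smul (c : ℝ) (ξ : L) (φ : T.Q) :
    T.bracketQ (c • ξ) φ = c * T.bracketQ ξ φ := by
  obtain ⟨σ, rfl⟩ := T.q_surjective φ
  simp only [bracketQ_q, map_smul, LinearMap.smul_apply, smul_eq_mul]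

theorem eq_zero_of_q_eq_zero_of_bracketQ_eq_zero {ξ : L} (hq : T.q ξ = 0)
    (hb : ∀ φ, T.bracketQ ξ φ = 0) : ξ = 0 := by
  refine T.nondegenerate ξ fun τ => ?_
  change T.ω ξ τ = 0
  rw [T.ω_apply, hb, hq, map_zero, sub_zero, mul_zero]

-- As `M + N = L`, one may correct `σ` by an element of `M` so that it differs from `ξ` by an
-- element of `N`.
theorem exists_q_eq_bracketQ_eq (ψ : T.Q) (ξ : L) :
    ∃ τ, T.q τ = ψ ∧ ∀ φ, T.bracketQ τ φ = T.bracketQ ξ φ := by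
  obtain ⟨σ, rfl⟩ := T.q_surjective ψ
  obtain ⟨m, hm, n, hn, hmn⟩ := Submodule.mem_sup.1 (T.span ▸ Submodule.mem_top : ξ - σ ∈ _)
  refine ⟨σ + m, ?_, fun φ => ?_⟩
  · rw [map_add, T.q_eq_zero_iff.2 hm, add_zero]
  · obtain ⟨τ, rfl⟩ := T.q_surjective φ
    have hnτ : T.bracket n τ = 0 := by rw [LinearMap.mem_ker.1 hn, LinearMap.zero_apply]
    rw [eq_add_of_sub_eq' hmn.symm, ← add_assoc, T.bracketQ_add (σ + m), T.bracketQ_q n, hnτ,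
      add_zero]

end Theory

variable {T : Theory L A}

namespace VacuumForm

variable (Ω : VacuumForm T)

theorem form_eq (φ φ' : T.Q) :
    Ω.form φ φ' = (Ω.reForm.form φ φ' : ℝ) + Complex.I * ((Ω.form φ φ').im : ℝ) := by
  rw [mul_comm]
  exact (Complex.re_add_im _).symm

theorem eq_of_forall_reForm_eq {φ ψ : T.Q}
    (h : ∀ φ', Ω.reForm.form φ φ' = Ω.reForm.form ψ φ') : φ = ψ := by
  rw [← sub_eq_zero]
  by_contra hne
  refine (Ω.reForm.pos _ hne).ne' ?_
  rw [Ω.reForm.form.map_sub, LinearMap.sub_apply, h, sub_self]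

theorem reForm_self_nonneg (φ : T.Q) : 0 ≤ Ω.reForm.form φ φ := by
  rcases eq_or_ne φ 0 with rfl | hφ
  · rw [map_zero]
  · exact (Ω.reForm.pos φ hφ).le

namespace IsAdmissible

variable {Ω} (hΩ : Ω.IsAdmissible)

/-- The continuous linear form `[ξ, ·] + Im Ω(q ξ, ·)`, which the Riesz isomorphism turns into the
momentum of `ξ`. -/
def momentumDual : L →ₗ[ℝ] StrongDual ℝ Ω.Space where
  toFun ξ := hΩ.bracketDual ξ + hΩ.imDual (T.q ξ)
  map_add' ξ τ := by
    ext φ'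
    obtain ⟨φ, rfl⟩ := Ω.toSpace.surjective φ'
    change T.bracketQ (ξ + τ) φ + (Ω.form (T.q (ξ + τ)) φ).im =
      T.bracketQ ξ φ + (Ω.form (T.q ξ) φ).im + (T.bracketQ τ φ + (Ω.form (T.q τ) φ).im)
    rw [T.bracketQ_add, map_add, map_add, LinearMap.add_apply, Complex.add_im]
    ring
  map_smul' c ξ := by
    ext φ'
    obtain ⟨φ, rfl⟩ := Ω.toSpace.surjective φ'
    change T.bracketQ (c • ξ) φ + (Ω.form (T.q (c • ξ)) φ).im =
      c * (T.bracketQ ξ φ + (Ω.form (T.q ξ) φ).im)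
    rw [T.bracketQ_smul, map_smul, map_smul, LinearMap.smul_apply, Complex.smul_im, smul_eq_mul]
    ring

/-- The momentum of a vector of `L`, complementing its position `q ξ`; it is defined by
`Re Ω(momentum ξ, φ) = [ξ, φ] + Im Ω(q ξ, φ)`. -/
def momentum : L →ₗ[ℝ] T.Q :=
  haveI := hΩ.complete
  Ω.toSpace.symm.toLinearMap ∘ₗ
    (InnerProductSpace.toDual ℝ Ω.Space).symm.toLinearEquiv.toLinearMap ∘ₗ hΩ.momentumDual

theorem innerSL_momentum (ξ : L) :
    innerSL ℝ (Ω.toSpace (hΩ.momentum ξ)) = hΩ.momentumDual ξ := by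
  have := hΩ.complete
  exact (InnerProductSpace.toDual ℝ Ω.Space).apply_symm_apply (hΩ.momentumDual ξ)

theorem reForm_momentum (ξ : L) (φ : T.Q) :
    Ω.reForm.form (hΩ.momentum ξ) φ = T.bracketQ ξ φ + (Ω.form (T.q ξ) φ).im :=
  congrArg (fun ℓ : StrongDual ℝ Ω.Space => ℓ (Ω.toSpace φ)) (hΩ.innerSL_momentum ξ)

theorem bracketQ_eq (ξ : L) (φ : T.Q) :
    T.bracketQ ξ φ = Ω.reForm.form (hΩ.momentum ξ) φ - (Ω.form (T.q ξ) φ).im := by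
  rw [hΩ.reForm_momentum, add_sub_cancel_right]

theorem ω_eq (ξ τ : L) : T.ω ξ τ =
    1 / 2 * (Ω.reForm.form (hΩ.momentum ξ) (T.q τ) - Ω.reForm.form (hΩ.momentum τ) (T.q ξ)) := by
  rw [T.ω_apply, hΩ.bracketQ_eq, hΩ.bracketQ_eq, Ω.symm (T.q τ) (T.q ξ)]
  ring

theorem momentum_prod_q_injective : Function.Injective (hΩ.momentum.prod T.q) := by
  rw [injective_iff_map_eq_zero]
  intro ξ h
  have hp : hΩ.momentum ξ = 0 := congrArg Prod.fst h
  have hq : T.q ξ = 0 := congrArg Prod.snd h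
  refine T.eq_zero_of_q_eq_zero_of_bracketQ_eq_zero hq fun φ => ?_
  simp only [hΩ.bracketQ_eq, hp, hq, map_zero, LinearMap.zero_apply, Complex.zero_im, sub_zero]

theorem momentum_prod_q_surjective : Function.Surjective (hΩ.momentum.prod T.q) := by
  rintro ⟨φ, ψ⟩
  obtain ⟨ξ, hξ⟩ := hΩ.exists_bracket (innerSL ℝ (Ω.toSpace φ) - hΩ.imDual ψ)
  obtain ⟨τ, hτ, hτ'⟩ := T.exists_q_eq_bracketQ_eq ψ ξ
  refine ⟨τ, Prod.ext (Ω.eq_of_forall_reForm_eq fun φ' => ?_) hτ⟩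
  have h : Ω.reForm.form φ φ' - (Ω.form ψ φ').im = T.bracketQ ξ φ' := hξ (Ω.toSpace φ')
  change Ω.reForm.form (hΩ.momentum τ) φ' = Ω.reForm.form φ φ'
  rw [hΩ.reForm_momentum, hτ, hτ', ← h, sub_add_cancel]

/-- The decomposition of `L` into momenta and positions. -/
def splitting : L ≃ₗ[ℝ] T.Q × T.Q :=
  LinearEquiv.ofBijective (hΩ.momentum.prod T.q)
    ⟨hΩ.momentum_prod_q_injective, hΩ.momentum_prod_q_surjective⟩

theorem ext_momentum_q {ξ τ : L} (hp : hΩ.momentum ξ = hΩ.momentum τ) (hq : T.q ξ = T.q τ) :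
    ξ = τ :=
  hΩ.momentum_prod_q_injective (Prod.ext hp hq)

@[simp]
theorem momentum_splitting_symm (x : T.Q × T.Q) : hΩ.momentum (hΩ.splitting.symm x) = x.1 :=
  congrArg Prod.fst (hΩ.splitting.apply_symm_apply x)

@[simp]
theorem q_splitting_symm (x : T.Q × T.Q) : T.q (hΩ.splitting.symm x) = x.2 :=
  congrArg Prod.snd (hΩ.splitting.apply_symm_apply x)

theorem reForm_momentum_add_reForm_q_pos {ξ : L} (hξ : ξ ≠ 0) :
    0 < Ω.reForm.form (hΩ.momentum ξ) (hΩ.momentum ξ) + Ω.reForm.form (T.q ξ) (T.q ξ) := by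
  rcases eq_or_ne (T.q ξ) 0 with hq | hq
  · refine add_pos_of_pos_of_nonneg (Ω.reForm.pos _ fun hp => hξ ?_) (Ω.reForm_self_nonneg _)
    exact hΩ.ext_momentum_q (hp.trans (map_zero _).symm) (hq.trans (map_zero _).symm)
  · exact add_pos_of_nonneg_of_pos (Ω.reForm_self_nonneg _) (Ω.reForm.pos _ hq)

/-- The complex structure corresponding to `Ω`: in terms of momentum and position it is
`(p, q) ↦ (-q, p)`. -/
def complexStructure : ComplexStructure T where
  J := hΩ.splitting.symm.toLinearMap ∘ₗ LinearMap.prod (-T.q) hΩ.momentum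
  sq ξ := hΩ.ext_momentum_q (by simp) (by simp)
  symplectic ξ τ := by
    rw [hΩ.ω_eq, hΩ.ω_eq]
    simp [Ω.reForm.symm (T.q _)]
    ring
  pos ξ hξ := by
    rw [hΩ.ω_eq]
    simpa using hΩ.reForm_momentum_add_reForm_q_pos hξ

theorem momentum_complexStructure (ξ : L) :
    hΩ.momentum (hΩ.complexStructure.J ξ) = -T.q ξ := by
  simp [complexStructure]

theorem q_complexStructure (ξ : L) : T.q (hΩ.complexStructure.J ξ) = hΩ.momentum ξ := by
  simp [complexStructure]

theorem g_complexStructure (ξ τ : L) : hΩ.complexStructure.g.form ξ τ =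
    Ω.reForm.form (hΩ.momentum ξ) (hΩ.momentum τ) + Ω.reForm.form (T.q ξ) (T.q τ) := by
  change 2 * T.ω ξ (hΩ.complexStructure.J τ) = _
  rw [hΩ.ω_eq, hΩ.momentum_complexStructure, hΩ.q_complexStructure, map_neg, LinearMap.neg_apply,
    Ω.reForm.symm (T.q τ)]
  ring

theorem corresponds_complexStructure : hΩ.complexStructure.Corresponds Ω := by
  refine ⟨hΩ.splitting.symm.toLinearMap ∘ₗ LinearMap.inr ℝ T.Q T.Q, fun φ => by simp, fun φ => ?_,
    fun φ φ' => ?_⟩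
  · refine ⟨hΩ.splitting.symm (φ, 0), T.q_eq_zero_iff.1 (by simp), hΩ.ext_momentum_q ?_ ?_⟩
    · simp [momentum_complexStructure]
    · simp [q_complexStructure]
  · rw [hΩ.g_complexStructure, hΩ.bracketQ_eq, Ω.form_eq]
    simp

section Uniqueness

variable {J : ComplexStructure T} {j : T.Q →ₗ[ℝ] L}

theorem momentum_section (hqj : ∀ φ, T.q (j φ) = φ)
    (hform : ∀ φ φ', Ω.form φ φ' =
      (J.g.form (j φ) (j φ') : ℂ) - Complex.I * (T.bracketQ (j φ) φ' : ℂ)) (φ : T.Q) :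
    hΩ.momentum (j φ) = 0 := by
  refine Ω.eq_of_forall_reForm_eq fun φ' => ?_
  rw [hΩ.reForm_momentum, hqj, congrArg Complex.im (hform φ φ')]
  simp

theorem momentum_J_section (hqj : ∀ φ, T.q (j φ) = φ)
    (hform : ∀ φ φ', Ω.form φ φ' =
      (J.g.form (j φ) (j φ') : ℂ) - Complex.I * (T.bracketQ (j φ) φ' : ℂ)) (φ : T.Q) :
    hΩ.momentum (J.J (j φ)) = -φ := by
  refine Ω.eq_of_forall_reForm_eq fun φ' => ?_
  have h : Ω.reForm.form φ φ' = J.g.form (j φ) (j φ') := by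
    simpa using! congrArg Complex.re (hform φ φ')
  have hg : J.g.form (j φ') (j φ) = 2 * T.ω (j φ') (J.J (j φ)) := rfl
  rw [J.g.symm, hg, hΩ.ω_eq, hΩ.momentum_section hqj hform, hqj] at h
  rw [map_neg, LinearMap.neg_apply, h]
  simp

theorem eq_complexStructure (hJ : J.Corresponds Ω) : J = hΩ.complexStructure := by
  obtain ⟨j, hqj, hjM, hform⟩ := hJ
  have hpj := hΩ.momentum_section hqj hform
  have hpJj := hΩ.momentum_J_section hqj hform
  have hqJj (φ : T.Q) : T.q (J.J (j φ)) = 0 := by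
    obtain ⟨m, hm, hmj⟩ := hjM φ
    rw [← hmj, J.sq, map_neg, T.q_eq_zero_iff.2 hm, neg_zero]
  have hdecomp (ξ : L) : ξ = j (T.q ξ) - J.J (j (hΩ.momentum ξ)) :=
    hΩ.ext_momentum_q (by simp [hpj, hpJj]) (by simp [hqj, hqJj])
  have hJ (ξ : L) : J.J ξ = J.J (j (T.q ξ)) + j (hΩ.momentum ξ) := by
    conv_lhs => rw [hdecomp ξ, map_sub, J.sq, sub_neg_eq_add]
  ext ξ
  refine hΩ.ext_momentum_q ?_ ?_
  · rw [hΩ.momentum_complexStructure, hJ, map_add, hpJj, hpj, add_zero]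
  · rw [hΩ.q_complexStructure, hJ, map_add, hqJj, hqj, zero_add]

end Uniqueness

theorem g_eq {J : ComplexStructure T} (hJ : J.Corresponds Ω) (ξ τ : L) : J.g.form ξ τ =
    Ω.reForm.form (hΩ.momentum ξ) (hΩ.momentum τ) + Ω.reForm.form (T.q ξ) (T.q τ) := by
  rw [hΩ.eq_complexStructure hJ, hΩ.g_complexStructure]

/-- The Hilbert space `L` is the orthogonal sum of two copies of `Q`. -/
def splittingIsometry : hΩ.complexStructure.Space ≃ₗᵢ[ℝ] WithLp 2 (Ω.Space × Ω.Space) where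
  toLinearEquiv := hΩ.complexStructure.toSpace.symm ≪≫ₗ hΩ.splitting ≪≫ₗ
    (Ω.toSpace.prodCongr Ω.toSpace) ≪≫ₗ (WithLp.linearEquiv 2 ℝ (Ω.Space × Ω.Space)).symm
  norm_map' ξ := by
    rw [← sq_eq_sq₀ (norm_nonneg _) (norm_nonneg _), ← real_inner_self_eq_norm_sq,
      ← real_inner_self_eq_norm_sq, WithLp.prod_inner_apply]
    exact (hΩ.g_complexStructure ξ ξ).symm

theorem separableSpace_complexStructure :
    TopologicalSpace.SeparableSpace hΩ.complexStructure.Space := by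
  have := hΩ.separable
  have : TopologicalSpace.SeparableSpace (WithLp 2 (Ω.Space × Ω.Space)) :=
    (WithLp.homeomorphProd 2 Ω.Space Ω.Space).symm.surjective.denseRange.separableSpace
      (WithLp.homeomorphProd 2 Ω.Space Ω.Space).symm.continuous
  exact hΩ.splittingIsometry.symm.surjective.denseRange.separableSpace
    hΩ.splittingIsometry.symm.continuous

theorem continuous_bracket_complexStructure :
    Continuous fun x : hΩ.complexStructure.Space × hΩ.complexStructure.Space =>
      T.bracket (hΩ.complexStructure.toSpace.symm x.1) (hΩ.complexStructure.toSpace.symm x.2) := by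
  set e := hΩ.splittingIsometry
  have hbracket (x : hΩ.complexStructure.Space × hΩ.complexStructure.Space) :
      T.bracket (hΩ.complexStructure.toSpace.symm x.1) (hΩ.complexStructure.toSpace.symm x.2) =
      inner ℝ (e x.1).fst (e x.2).snd - Ω.imLeft (Ω.toSpace.symm (e x.1).snd) (e x.2).snd :=
    hΩ.bracketQ_eq (hΩ.complexStructure.toSpace.symm x.1)
      (T.q (hΩ.complexStructure.toSpace.symm x.2))
  have hfst : Continuous fun y : WithLp 2 (Ω.Space × Ω.Space) => y.fst := by fun_prop
  have hsnd : Continuous fun y : WithLp 2 (Ω.Space × Ω.Space) => y.snd := by fun_prop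
  simp only [hbracket]
  have he₁ := e.continuous.comp
    (continuous_fst (X := hΩ.complexStructure.Space) (Y := hΩ.complexStructure.Space))
  have he₂ := e.continuous.comp
    (continuous_snd (X := hΩ.complexStructure.Space) (Y := hΩ.complexStructure.Space))
  exact ((hfst.comp he₁).inner (hsnd.comp he₂)).sub
    (hΩ.continuous_im.comp ((hsnd.comp he₁).prodMk (hsnd.comp he₂)))

theorem isAdmissible_complexStructure : hΩ.complexStructure.IsAdmissible where
  complete := by
    have := hΩ.complete
    exact (completeSpace_congr (e := hΩ.splittingIsometry.toEquiv)
      hΩ.splittingIsometry.isometry.isUniformEmbedding).2 inferInstance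
  separable := hΩ.separableSpace_complexStructure
  continuous_bracket := hΩ.continuous_bracket_complexStructure

theorem existsUnique_complexStructure (hΩ : Ω.IsAdmissible) :
    ∃! J : ComplexStructure T, J.IsAdmissible ∧ J.Corresponds Ω :=
  ⟨hΩ.complexStructure, ⟨hΩ.isAdmissible_complexStructure, hΩ.corresponds_complexStructure⟩,
    fun _ hJ => hΩ.eq_complexStructure hJ.2⟩

end IsAdmissible

end VacuumForm

/-! ### The Schrödinger representation -/

namespace VacuumForm.IsAdmissible

variable {Ω : VacuumForm T} (hΩ : Ω.IsAdmissible)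

theorem isCanonicalGaussian_νQ (hΩ : Ω.IsAdmissible) : IsCanonicalGaussian (1 / 2) Ω.νQ :=
  haveI := hΩ.complete
  isCanonicalGaussian_gaussian (1 / 2)

theorem coherent_eq (τ η : A) (φ : Ω.QHat) :
    hΩ.coherent τ η φ =
      Complex.exp (Complex.I * (T.θ τ (η -ᵥ τ) : ℝ)
          - 1 / 2 * Ω.form (T.q (η -ᵥ τ)) (T.q (η -ᵥ τ))) *
        Complex.exp (-1 * (φ (innerSL ℝ (Ω.toSpace (T.q (η -ᵥ τ)))) : ℝ)
          + -Complex.I * (φ (innerSL ℝ (Ω.toSpace (hΩ.momentum (η -ᵥ τ)))) : ℝ)) := by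
  have hdual : hΩ.momentumDual (η -ᵥ τ) =
      hΩ.bracketDual (η -ᵥ τ) + hΩ.imDual (T.q (η -ᵥ τ)) := rfl
  rw [coherent, hΩ.innerSL_momentum, hdual, map_add, ← Complex.exp_add]
  congr 1
  push_cast
  ring

theorem memLp_coherent (τ η : A) : MemLp (hΩ.coherent τ η) 2 Ω.νQ := by
  rw [funext (hΩ.coherent_eq τ η)]
  exact (hΩ.isCanonicalGaussian_νQ.memLp_cexp _ _ _ _).const_mul _

@[simp]
theorem coherent_self (η : A) (φ : Ω.QHat) : hΩ.coherent η η φ = 1 := by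
  simp [coherent_eq]

theorem coherent_mul_coherent (τ η η' : A) (φ : Ω.QHat) :
    hΩ.coherent τ η (φ + Ω.incl (T.q (η' -ᵥ η))) * hΩ.coherent η η' φ = hΩ.coherent τ η' φ := by
  have hv : η' -ᵥ τ = (η -ᵥ τ) + (η' -ᵥ η) := by rw [add_comm, vsub_add_vsub_cancel]
  simp only [coherent_eq, ← Complex.exp_add, hv, T.θ_eq τ η]
  generalize η -ᵥ τ = v
  generalize η' -ᵥ η = w
  have hq : Ω.incl (T.q w) (innerSL ℝ (Ω.toSpace (T.q v))) = Ω.reForm.form (T.q v) (T.q w) := rfl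
  have hp : Ω.incl (T.q w) (innerSL ℝ (Ω.toSpace (hΩ.momentum v))) =
    Ω.reForm.form (hΩ.momentum v) (T.q w) := rfl
  simp only [map_add, LinearMap.add_apply, hq, hp, hΩ.reForm_momentum v, T.bracketQ_q,
    Ω.symm (T.q w) (T.q v)]
  congr 1
  push_cast
  linear_combination Ω.form_eq (T.q v) (T.q w)

theorem norm_sq_coherent (η η' : A) (φ : Ω.QHat) :
    ‖hΩ.coherent η η' φ‖ ^ 2 = cameronMartinDensity (1 / 2) (Ω.toSpace (T.q (η' -ᵥ η))) φ := by
  have hre : inner ℝ (Ω.toSpace (T.q (η' -ᵥ η))) (Ω.toSpace (T.q (η' -ᵥ η))) =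
    (Ω.form (T.q (η' -ᵥ η)) (T.q (η' -ᵥ η))).re := rfl
  rw [coherent_eq, ← Complex.exp_add, Complex.norm_exp, ← Real.exp_nat_mul, cameronMartinDensity,
    hre]
  congr 1
  simp
  ring

theorem quasiMeasurePreserving_add_incl (hΩ : Ω.IsAdmissible) (φ : T.Q) :
    Measure.QuasiMeasurePreserving (fun x => x + Ω.incl φ) Ω.νQ Ω.νQ :=
  haveI := hΩ.complete
  hΩ.isCanonicalGaussian_νQ.quasiMeasurePreserving_add_incl (by norm_num) (Ω.toSpace φ)

theorem eLpNorm_translate (η η' : A) {f : Ω.QHat → ℂ} (hf : AEStronglyMeasurable f Ω.νQ) :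
    eLpNorm (fun φ => f (φ + Ω.incl (T.q (η' -ᵥ η))) * hΩ.coherent η η' φ) 2 Ω.νQ =
      eLpNorm f 2 Ω.νQ :=
  haveI := hΩ.complete
  hΩ.isCanonicalGaussian_νQ.eLpNorm_translate_mul (by norm_num) (Ω.toSpace (T.q (η' -ᵥ η))) hf
    (hΩ.norm_sq_coherent η η')

theorem memLp_translate (η η' : A) {f : Ω.QHat → ℂ} (hf : MemLp f 2 Ω.νQ) :
    MemLp (fun φ => f (φ + Ω.incl (T.q (η' -ᵥ η))) * hΩ.coherent η η' φ) 2 Ω.νQ :=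
  ⟨(hf.1.comp_quasiMeasurePreserving (hΩ.quasiMeasurePreserving_add_incl _)).mul
    (hΩ.memLp_coherent η η').1, (hΩ.eLpNorm_translate η η' hf.1).trans_lt hf.2⟩

theorem ae_eq_translate (Ψ : hΩ.stateSpace) (η η' : A) :
    (Ψ : A → Lp ℂ 2 Ω.νQ) η' =ᵐ[Ω.νQ] fun φ =>
      (Ψ : A → Lp ℂ 2 Ω.νQ) η (φ + Ω.incl (T.q (η' -ᵥ η))) * hΩ.coherent η η' φ := by
  obtain ⟨f, hf, hf'⟩ := Ψ.2
  filter_upwards [hf η', (hΩ.quasiMeasurePreserving_add_incl (T.q (η' -ᵥ η))).ae (hf η)]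
    with φ h h'
  rw [h, h', hf']

theorem norm_apply_eq (Ψ : hΩ.stateSpace) (η η' : A) :
    ‖(Ψ : A → Lp ℂ 2 Ω.νQ) η‖ = ‖(Ψ : A → Lp ℂ 2 Ω.νQ) η'‖ := by
  rw [Lp.norm_def, Lp.norm_def, eLpNorm_congr_ae (hΩ.ae_eq_translate Ψ η η'),
    hΩ.eLpNorm_translate η η' (Lp.aestronglyMeasurable _)]

theorem exists_state_apply_eq (η : A) (F : Lp ℂ 2 Ω.νQ) :
    ∃ Ψ : hΩ.stateSpace, (Ψ : A → Lp ℂ 2 Ω.νQ) η = F := by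
  have hF (η' : A) := hΩ.memLp_translate η η' (Lp.memLp F)
  refine ⟨⟨fun η' => (hF η').toLp, fun η' φ => F (φ + Ω.incl (T.q (η' -ᵥ η))) * hΩ.coherent η η' φ,
    fun η' => (hF η').coeFn_toLp, fun η' η'' φ => ?_⟩, ?_⟩
  · beta_reduce
    rw [← hΩ.coherent_mul_coherent η η' η'', ← mul_assoc, add_assoc φ, ← map_add, ← map_add,
      vsub_add_vsub_cancel]
  · refine Lp.ext ((hF η).coeFn_toLp.trans (ae_of_all _ fun φ => ?_))
    simp

theorem bijective_proj_stateSpace (η : A) :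
    Function.Bijective (LinearMap.proj η ∘ₗ hΩ.stateSpace.subtype) := by
  refine ⟨(injective_iff_map_eq_zero _).2 fun Ψ hΨ => ?_, hΩ.exists_state_apply_eq η⟩
  refine Subtype.ext (funext fun η' => norm_eq_zero.1 ?_)
  rw [hΩ.norm_apply_eq Ψ η' η]
  exact norm_eq_zero.2 hΨ

/-- The identification of the Schrödinger state space with `L²(Q̂, ν_Q)` given by the `η`-reduced
wave function. -/
def reduce (η : A) : hΩ.stateSpace ≃ₗ[ℂ] Lp ℂ 2 Ω.νQ :=
  LinearEquiv.ofBijective _ (hΩ.bijective_proj_stateSpace η)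

theorem norm_reduce (η η' : A) (Ψ : hΩ.stateSpace) : ‖hΩ.reduce η Ψ‖ = ‖hΩ.reduce η' Ψ‖ :=
  hΩ.norm_apply_eq Ψ η η'

theorem inner_reduce (η η' : A) (Ψ Φ : hΩ.stateSpace) :
    inner ℂ (hΩ.reduce η Ψ) (hΩ.reduce η Φ) = inner ℂ (hΩ.reduce η' Ψ) (hΩ.reduce η' Φ) := by
  let U : Lp ℂ 2 Ω.νQ ≃ₗᵢ[ℂ] Lp ℂ 2 Ω.νQ :=
    { toLinearEquiv := (hΩ.reduce η').symm ≪≫ₗ hΩ.reduce η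
      norm_map' := fun F => by simp [hΩ.norm_reduce η η'] }
  simpa [U] using! U.inner_map_map (hΩ.reduce η' Ψ) (hΩ.reduce η' Φ)

/-- The coherent state of `τ` in the Schrödinger representation. -/
def coherentState (τ : A) : hΩ.stateSpace :=
  ⟨fun η => (hΩ.memLp_coherent τ η).toLp, hΩ.coherent τ,
    fun η => (hΩ.memLp_coherent τ η).coeFn_toLp,
    fun η η' φ => (hΩ.coherent_mul_coherent τ η η' φ).symm⟩

theorem reduce_coherentState_ae_eq (τ η : A) :
    hΩ.reduce η (hΩ.coherentState τ) =ᵐ[Ω.νQ] hΩ.coherent τ η :=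
  (hΩ.memLp_coherent τ η).coeFn_toLp

theorem inner_reduce_coherentState_left (τ η : A) (F : Lp ℂ 2 Ω.νQ) :
    inner ℂ (hΩ.reduce η (hΩ.coherentState τ)) F =
      ∫ φ, conj (hΩ.coherent τ η φ) * F φ ∂Ω.νQ := by
  rw [L2.inner_def]
  refine integral_congr_ae ?_
  filter_upwards [hΩ.reduce_coherentState_ae_eq τ η] with φ h
  rw [h, RCLike.inner_apply, mul_comm]

theorem integral_coherent {J : ComplexStructure T} (hJ : J.Corresponds Ω) (τ η : A) :
    ∫ φ, hΩ.coherent τ η φ ∂Ω.νQ = J.coherent τ η := by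
  simp only [coherent_eq]
  rw [integral_const_mul, hΩ.isCanonicalGaussian_νQ.integral_cexp, ← Complex.exp_add,
    ComplexStructure.coherent, hΩ.g_eq hJ, T.θ_eq τ η, ← T.bracketQ_q]
  generalize η -ᵥ τ = v
  have hinner (a b : T.Q) : inner ℝ (Ω.toSpace a) (Ω.toSpace b) = Ω.reForm.form a b := rfl
  rw [hinner, hinner, hinner, hΩ.bracketQ_eq, Ω.form_eq (T.q v) (T.q v),
    Ω.reForm.symm (hΩ.momentum v) (T.q v)]
  congr 1
  simp
  ring

-- Since the inner product does not depend on the base point, it may be computed at `ζ`, where the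
-- coherent state of `ζ` is the constant function `1`.
theorem inner_reduce_coherentState {J : ComplexStructure T} (hJ : J.Corresponds Ω) (η ζ ζ' : A) :
    inner ℂ (hΩ.reduce η (hΩ.coherentState ζ)) (hΩ.reduce η (hΩ.coherentState ζ')) =
      J.coherent ζ' ζ := by
  rw [hΩ.inner_reduce η ζ, inner_reduce_coherentState_left, ← hΩ.integral_coherent hJ]
  simp only [coherent_self, map_one, one_mul]
  exact integral_congr_ae (hΩ.reduce_coherentState_ae_eq ζ' ζ)

theorem conj_coherent_of_q_eq_zero {τ η : A} (hq : T.q (η -ᵥ τ) = 0) (φ : Ω.QHat) :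
    conj (hΩ.coherent τ η φ) = Complex.exp (-(Complex.I * (T.θ τ (η -ᵥ τ) : ℝ))) *
      Extension.character (innerSL ℝ (Ω.toSpace (hΩ.momentum (η -ᵥ τ)))) φ := by
  rw [coherent_eq, hq, Extension.character, map_mul, ← Complex.exp_conj, ← Complex.exp_conj]
  simp [mul_comm]

theorem isTotalFamily_reduce_coherentState (η : A) :
    IsTotalFamily ℂ fun τ => hΩ.reduce η (hΩ.coherentState τ) := by
  have := hΩ.complete
  have := hΩ.isCanonicalGaussian_νQ.isProbabilityMeasure
  refine isTotalFamily_of_forall_inner_eq_zero fun F hF => (Lp.eq_zero_iff_ae_eq_zero).2 ?_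
  refine Extension.ae_eq_zero_of_integral_character_mul
    ((Lp.memLp F).integrable one_le_two) fun ℓ => ?_
  obtain ⟨l, rfl⟩ : ∃ l, innerSL ℝ l = ℓ := (InnerProductSpace.toDual ℝ Ω.Space).surjective ℓ
  obtain ⟨v, hq, hp⟩ : ∃ v, T.q v = 0 ∧ Ω.toSpace (hΩ.momentum v) = l :=
    ⟨hΩ.splitting.symm (Ω.toSpace.symm l, 0), by simp, by simp⟩
  have hv : η -ᵥ (-v +ᵥ η) = v := by rw [vsub_vadd_eq_vsub_sub, vsub_self, zero_sub, neg_neg]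
  have h := hF (-v +ᵥ η)
  rw [inner_reduce_coherentState_left] at h
  simp only [hΩ.conj_coherent_of_q_eq_zero (hv.symm ▸ hq), hv, hp, mul_assoc] at h
  rw [integral_const_mul] at h
  exact (mul_eq_zero.1 h).resolve_left (Complex.exp_ne_zero _)

end VacuumForm.IsAdmissible

/-! ### Mean values of entire functions -/

section MeanValue

variable {F : Type*} [NormedAddCommGroup F] [NormedSpace ℂ F] [CompleteSpace F]

theorem integral_circle_smul_eq {V : Type*} [NormedAddCommGroup V] [NormedSpace ℂ V] {p : V → F}
    (hp : Differentiable ℂ p) (z : V) :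
    ∫ t in (0 : ℝ)..2 * Real.pi, p (Complex.exp (t * Complex.I) • z) = (2 * Real.pi) • p 0 := by
  have hu : Differentiable ℂ fun w : ℂ => p (w • z) := hp.comp (by fun_prop)
  have h := (hu.diffContOnCl (s := Metric.ball 0 |1|)).circleAverage
  rw [Real.circleAverage_def, inv_smul_eq_iff₀ Real.two_pi_pos.ne', zero_smul] at h
  simpa [circleMap] using h

theorem integral_comp_of_measurePreserving {X Y G : Type*} [MeasurableSpace X] [MeasurableSpace Y]
    [NormedAddCommGroup G] [NormedSpace ℝ G] {μ : Measure X} {ν : Measure Y} {φ : X → Y}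
    (hφ : MeasurePreserving φ μ ν) {g : Y → G} (hg : AEStronglyMeasurable g ν) :
    ∫ x, g (φ x) ∂μ = ∫ y, g y ∂ν := by
  rw [← hφ.map_eq] at hg ⊢
  exact (integral_map hφ.measurable.aemeasurable hg).symm

theorem integral_eq_of_intervalIntegral_comp_eq {X : Type*} [MeasurableSpace X] {μ : Measure X}
    [IsProbabilityMeasure μ] {R : ℝ → X → X} (hR : ∀ t, MeasurePreserving (R t) μ μ) {f : X → F}
    (hf : Integrable f μ) {T : ℝ} (hT : T ≠ 0)
    (hm : AEStronglyMeasurable (Function.uncurry fun t x => f (R t x))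
      ((volume.restrict (Set.uIoc 0 T)).prod μ))
    {c : F} (h : ∀ x, ∫ t in (0 : ℝ)..T, f (R t x) = T • c) : ∫ x, f x ∂μ = c := by
  have hprod : Integrable (Function.uncurry fun t x => f (R t x))
      ((volume.restrict (Set.uIoc 0 T)).prod μ) := by
    refine (integrable_prod_iff hm).2
      ⟨ae_of_all _ fun t => (hR t).integrable_comp_of_integrable hf, ?_⟩
    have : IsFiniteMeasure (volume.restrict (Set.uIoc 0 T)) := by
      rw [Set.uIoc]
      infer_instance
    simp only [Function.uncurry_apply_pair,
      fun t => integral_comp_of_measurePreserving (hR t) hf.norm.1]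
    exact integrable_const _
  have hswap := intervalIntegral_integral_swap (μ := μ) hprod
  simp only [fun t => integral_comp_of_measurePreserving (hR t) hf.1, h,
    intervalIntegral.integral_const, integral_const, probReal_univ, one_smul, sub_zero] at hswap
  exact smul_right_injective F hT hswap

end MeanValue

/-! ### The holomorphic representation -/

namespace Extension

variable {E F : Type*} [NormedAddCommGroup E] [InnerProductSpace ℝ E] [NormedAddCommGroup F]
  [InnerProductSpace ℝ F]

/-- The extension of a continuous linear map `E → F` to `Ê → F̂`. -/
def map (U : E →L[ℝ] F) : Extension E →ₗ[ℝ] Extension F :=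
  (ContinuousLinearMap.precomp ℝ U).toLinearMap.dualMap

theorem map_apply (U : E →L[ℝ] F) (x : Extension E) (ℓ : StrongDual ℝ F) :
    map U x ℓ = x (ℓ.comp U) := rfl

theorem measurable_map (U : E →L[ℝ] F) : Measurable (map U) :=
  measurable_of_apply fun _ => measurable_apply _

theorem map_isometryEquiv_innerSL (U : E ≃ₗᵢ[ℝ] F) (x : Extension E) (a : F) :
    map (U : E →L[ℝ] F) x (innerSL ℝ a) = x (innerSL ℝ (U.symm a)) := by
  rw [map_apply]
  congr 1
  ext y
  exact (U.symm.inner_map_eq_flip a y).symm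

theorem exists_mem_inner_eq (W : Submodule ℝ E) [FiniteDimensional ℝ W] (x : Extension E) :
    ∃ w ∈ W, ∀ a ∈ W, x (innerSL ℝ a) = inner ℝ a w := by
  let u : W →ₗ[ℝ] ℝ := x ∘ₗ (innerSL ℝ).toLinearMap ∘ₗ W.subtype
  let w := (InnerProductSpace.toDual ℝ W).symm (LinearMap.toContinuousLinearMap u)
  refine ⟨w, w.2, fun a ha => ?_⟩
  have h : inner ℝ w (⟨a, ha⟩ : W) = u ⟨a, ha⟩ := InnerProductSpace.toDual_symm_apply
  rw [real_inner_comm]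
  exact h.symm

end Extension

namespace IsCanonicalGaussian

variable {E F : Type*} [NormedAddCommGroup E] [InnerProductSpace ℝ E] [NormedAddCommGroup F]
  [InnerProductSpace ℝ F] {v : ℝ≥0} {ν : Measure (Extension E)} {ν' : Measure (Extension F)}

theorem map_isometryEquiv (hν : IsCanonicalGaussian v ν) (U : E ≃ₗᵢ[ℝ] F) :
    IsCanonicalGaussian v (ν.map (Extension.map (U : E →L[ℝ] F))) := fun ℓ => by
  rw [Measure.map_map (measurable_extension_apply ℓ) (Extension.measurable_map _)]
  have hU : ‖ℓ.comp (U : E →L[ℝ] F)‖₊ = ‖ℓ‖₊ :=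
    NNReal.eq (ContinuousLinearMap.opNorm_comp_linearIsometryEquiv ℓ U)
  rw [← hU]
  exact hν _

theorem measurePreserving_map (hν : IsCanonicalGaussian v ν) (hν' : IsCanonicalGaussian v ν')
    (U : E ≃ₗᵢ[ℝ] F) : MeasurePreserving (Extension.map (U : E →L[ℝ] F)) ν ν' :=
  ⟨Extension.measurable_map _, (hν.map_isometryEquiv U).unique hν'⟩

end IsCanonicalGaussian

namespace ComplexStructure

variable (J : ComplexStructure T)

theorem inner_toSpace (ξ τ : L) : inner ℝ (J.toSpace ξ) (J.toSpace τ) = J.g.form ξ τ := rfl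

theorem g_J_right (ξ τ : L) : J.g.form ξ (J.J τ) = -J.g.form (J.J ξ) τ := by
  change 2 * T.ω ξ (J.J (J.J τ)) = -(2 * T.ω (J.J ξ) (J.J τ))
  rw [J.symplectic, J.sq, map_neg, mul_neg]

theorem g_J_J (ξ τ : L) : J.g.form (J.J ξ) (J.J τ) = J.g.form ξ τ := by
  rw [g_J_right, J.sq, map_neg, LinearMap.neg_apply, neg_neg]

theorem coord_add (σ : L) (x y : J.LHat) : J.coord σ (x + y) = J.coord σ x + J.coord σ y := by
  simp only [coord, LinearMap.add_apply]
  push_cast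
  ring

@[simp]
theorem coord_zero (σ : L) : J.coord σ 0 = 0 := by simp [coord]

theorem coord_incl_self (σ : L) : J.coord σ (J.incl σ) = (J.g.form σ σ : ℝ) := by
  have h : T.ω σ σ = 0 := by rw [T.ω_apply]; ring
  rw [coord_incl, h]
  simp

@[fun_prop]
theorem measurable_coord (σ : L) : Measurable (J.coord σ) := by
  unfold coord
  fun_prop

/-- The rotation `exp (t J) = cos t + sin t J` of `(L, g)`. -/
def rotation (t : ℝ) : J.Space ≃ₗᵢ[ℝ] J.Space :=
  (J.toSpace.symm ≪≫ₗ
    (LinearEquiv.ofLinearMap (Real.cos t • LinearMap.id + Real.sin t • J.J)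
      (Real.cos t • LinearMap.id - Real.sin t • J.J)
      (LinearMap.ext fun ξ => by
        simp only [LinearMap.comp_apply, LinearMap.add_apply, LinearMap.sub_apply,
          LinearMap.smul_apply, LinearMap.id_apply, map_sub, map_smul, J.sq]
        linear_combination (norm := module) (Real.cos_sq_add_sin_sq t) • ξ)
      (LinearMap.ext fun ξ => by
        simp only [LinearMap.comp_apply, LinearMap.add_apply, LinearMap.sub_apply,
          LinearMap.smul_apply, LinearMap.id_apply, map_add, map_smul, J.sq]
        linear_combination (norm := module) (Real.cos_sq_add_sin_sq t) • ξ)) ≪≫ₗ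
    J.toSpace).isometryOfInner fun x y => by
      obtain ⟨ξ, rfl⟩ := J.toSpace.surjective x
      obtain ⟨τ, rfl⟩ := J.toSpace.surjective y
      change J.g.form (Real.cos t • ξ + Real.sin t • J.J ξ)
        (Real.cos t • τ + Real.sin t • J.J τ) = J.g.form ξ τ
      simp only [map_add, map_smul, LinearMap.add_apply, LinearMap.smul_apply, smul_eq_mul,
        J.g_J_J ξ τ, J.g_J_right ξ τ]
      linear_combination J.g.form ξ τ * Real.cos_sq_add_sin_sq t

theorem rotation_symm_toSpace (t : ℝ) (ξ : L) :
    (J.rotation t).symm (J.toSpace ξ) =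
      J.toSpace (Real.cos t • ξ - Real.sin t • J.J ξ) := rfl

/-- The extension of the rotation `exp (t J)` to `L̂`. -/
def rotationHat (t : ℝ) : J.LHat →ₗ[ℝ] J.LHat :=
  Extension.map (J.rotation t : J.Space →L[ℝ] J.Space)

theorem coord_rotationHat (t : ℝ) (σ : L) (x : J.LHat) :
    J.coord σ (J.rotationHat t x) = Complex.exp (t * Complex.I) * J.coord σ x := by
  simp only [coord, rotationHat, Extension.map_isometryEquiv_innerSL, rotation_symm_toSpace,
    Complex.exp_mul_I, J.sq, map_sub, map_smul, map_neg, smul_eq_mul]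
  push_cast
  linear_combination (-Complex.sin t * (x (innerSL ℝ (J.toSpace (J.J σ))) : ℝ)) * Complex.I_sq

theorem exists_finiteDimensional_invariant {n : ℕ} (σ : Fin n → L) :
    ∃ V : Submodule ℝ L, FiniteDimensional ℝ V ∧ (∀ v ∈ V, J.J v ∈ V) ∧ ∀ i, σ i ∈ V := by
  let W := Submodule.span ℝ (Set.range σ)
  have hW : FiniteDimensional ℝ W := FiniteDimensional.span_of_finite ℝ (Set.finite_range σ)
  refine ⟨W ⊔ W.map J.J, inferInstance, fun v hv => ?_,
    fun i => Submodule.mem_sup_left (Submodule.subset_span (Set.mem_range_self i))⟩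
  obtain ⟨a, ha, _, ⟨b, hb, rfl⟩, rfl⟩ := Submodule.mem_sup.1 hv
  rw [map_add, J.sq, add_comm]
  exact Submodule.add_mem_sup (neg_mem hb) (Submodule.mem_map_of_mem ha)

variable {J}

theorem exists_coord_eq_coord_incl {V : Submodule ℝ L} [FiniteDimensional ℝ V]
    (hV : ∀ v ∈ V, J.J v ∈ V) (x : J.LHat) :
    ∃ w ∈ V, ∀ a ∈ V, J.coord a x = J.coord a (J.incl w) := by
  obtain ⟨_, ⟨w, hw, rfl⟩, h⟩ :=
    Extension.exists_mem_inner_eq (V.map J.toSpace.toLinearMap) x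
  have h' (a : L) (ha : a ∈ V) :
      x (innerSL ℝ (J.toSpace a)) = J.incl w (innerSL ℝ (J.toSpace a)) :=
    h _ (Submodule.mem_map_of_mem ha)
  exact ⟨w, hw, fun a ha => by rw [coord, coord, h' a ha, h' _ (hV a ha)]⟩

theorem IsHolCylinder.translate_mul {f : J.LHat → ℂ} (hf : J.IsHolCylinder f) (ξ : L) :
    J.IsHolCylinder fun x => Complex.exp (-(1 / 2 * J.coord ξ x)) * f (x + J.incl ξ) := by
  obtain ⟨n, σ, p, hp, hfp⟩ := hf
  refine ⟨n + 1, Fin.cons ξ σ, fun z => Complex.exp (-(1 / 2 * z 0)) *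
    p (fun i => z i.succ + J.coord (σ i) (J.incl ξ)), ?_, fun x => ?_⟩
  · exact Differentiable.mul (by fun_prop) (hp.comp (by fun_prop))
  · simp only [hfp, coord_add, Fin.cons_zero, Fin.cons_succ]

theorem exists_isHolCylinder_of_mem_span {G : Lp ℂ 2 J.νL}
    (hG : G ∈ Submodule.span ℂ {F : Lp ℂ 2 J.νL | ∃ f, J.IsHolCylinder f ∧ F =ᵐ[J.νL] f}) :
    ∃ f, J.IsHolCylinder f ∧ G =ᵐ[J.νL] f := by
  induction hG using Submodule.span_induction with
  | mem _ h => exact h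
  | zero => exact ⟨0, ⟨0, Fin.elim0, 0, by fun_prop, fun _ => rfl⟩, Lp.coeFn_zero _ _ _⟩
  | add _ _ _ _ hF hG =>
    obtain ⟨f, hf, hFf⟩ := hF
    obtain ⟨g, hg, hGg⟩ := hG
    exact ⟨f + g, hf.add J hg, (Lp.coeFn_add _ _).trans (hFf.add hGg)⟩
  | smul c _ _ hF =>
    obtain ⟨f, hf, hFf⟩ := hF
    exact ⟨c • f, hf.smul J c, (Lp.coeFn_smul _ _).trans (hFf.const_smul c)⟩

theorem mem_H2_of_isHolCylinder {f : J.LHat → ℂ} {F : Lp ℂ 2 J.νL} (hf : J.IsHolCylinder f)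
    (hF : F =ᵐ[J.νL] f) : F ∈ J.H2 :=
  Submodule.le_topologicalClosure _ (Submodule.subset_span ⟨f, hf, hF⟩)

theorem isClosed_H2 : IsClosed (J.H2 : Set (Lp ℂ 2 J.νL)) :=
  Submodule.isClosed_topologicalClosure _

instance : CompleteSpace J.H2 :=
  isClosed_H2.completeSpace_coe

variable (J)

/-- The holomorphic function `exp ({σ, ·} / 2)` on `L̂`, which is the reproducing kernel of
`H²(L̂, ν_L)` at `σ ∈ L`. -/
def expo (σ : L) (x : J.LHat) : ℂ := Complex.exp (1 / 2 * J.coord σ x)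

theorem isHolCylinder_expo (σ : L) : J.IsHolCylinder (J.expo σ) :=
  ⟨1, fun _ => σ, fun z => Complex.exp (1 / 2 * z 0), by fun_prop, fun _ => rfl⟩

theorem cameronMartinDensity_mul_conj_expo (ξ : L) (x : J.LHat) :
    (cameronMartinDensity 1 (J.toSpace ξ) x : ℂ) * conj (J.expo ξ (x + J.incl ξ)) =
      Complex.exp (-(1 / 2 * J.coord ξ x)) := by
  rw [cameronMartinDensity, expo, coord_add, coord_incl_self, ← Complex.exp_conj,
    Complex.ofReal_exp, ← Complex.exp_add, inner_toSpace]
  congr 1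
  simp [coord, Complex.conj_ofNat]
  ring

variable [CompleteSpace J.Space]

theorem isCanonicalGaussian_νL : IsCanonicalGaussian 1 J.νL :=
  isCanonicalGaussian_gaussian 1

theorem measurePreserving_rotationHat (t : ℝ) : MeasurePreserving (J.rotationHat t) J.νL J.νL :=
  J.isCanonicalGaussian_νL.measurePreserving_map J.isCanonicalGaussian_νL (J.rotation t)

theorem memLp_expo (σ : L) : MemLp (J.expo σ) 2 J.νL := by
  convert! J.isCanonicalGaussian_νL.memLp_cexp (J.toSpace σ) (J.toSpace (J.J σ)) (1 / 2)
    (1 / 2 * Complex.I) using 2 with x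
  rw [expo, coord]
  ring_nf

variable {J}

-- The rotations `exp (t J)` preserve the measure and multiply the coordinates by `exp (i t)`, so
-- the mean over `L̂` is a mean over circles.
theorem IsHolCylinder.integral_eq {f : J.LHat → ℂ} (hf : J.IsHolCylinder f)
    (hi : Integrable f J.νL) : ∫ x, f x ∂J.νL = f 0 := by
  have := J.isCanonicalGaussian_νL.isProbabilityMeasure
  obtain ⟨n, σ, p, hp, hfp⟩ := hf
  have hrot (t : ℝ) (x : J.LHat) : f (J.rotationHat t x) =
      p (Complex.exp (t * Complex.I) • fun i => J.coord (σ i) x) := by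
    simp only [hfp, coord_rotationHat]
    rfl
  have h0 : f 0 = p 0 := by simp only [hfp, coord_zero]; rfl
  refine integral_eq_of_intervalIntegral_comp_eq J.measurePreserving_rotationHat hi
    Real.two_pi_pos.ne' (Measurable.aestronglyMeasurable ?_) fun x => ?_
  · simp only [Function.uncurry_def, hrot]
    have (i : Fin n) : Measurable fun y : ℝ × J.LHat => J.coord (σ i) y.2 :=
      (J.measurable_coord (σ i)).comp measurable_snd
    refine hp.continuous.measurable.comp (measurable_pi_iff.2 fun i => ?_)
    exact Measurable.mul (by fun_prop) (this i)
  · simp only [hrot, integral_circle_smul_eq hp, h0]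

-- The Cameron–Martin translation by `ξ` turns the left-hand side into the mean of a holomorphic
-- cylinder function.
theorem IsHolCylinder.integral_conj_expo_mul {f : J.LHat → ℂ} (hf : J.IsHolCylinder f)
    (hf2 : MemLp f 2 J.νL) (ξ : L) : ∫ x, conj (J.expo ξ x) * f x ∂J.νL = f (J.incl ξ) := by
  have hG : Integrable (fun x => conj (J.expo ξ x) * f x) J.νL :=
    MemLp.integrable_mul (p := 2) (q := 2) (J.memLp_expo ξ).star hf2
  have hi := J.isCanonicalGaussian_νL.integrable_cameronMartinDensity_mul one_ne_zero
    (J.toSpace ξ) hG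
  rw [← J.isCanonicalGaussian_νL.integral_cameronMartinDensity_mul one_ne_zero (J.toSpace ξ) hG.1]
  have key (x : J.LHat) := J.cameronMartinDensity_mul_conj_expo ξ x
  change ∀ x, _ * conj (J.expo ξ (x + Extension.incl J.Space (J.toSpace ξ))) = _ at key
  simp only [← mul_assoc, key] at hi ⊢
  refine ((hf.translate_mul ξ).integral_eq hi).trans ?_
  simp

end ComplexStructure

namespace ComplexStructure

variable (J : ComplexStructure T) [CompleteSpace J.Space]

/-- The class in `L²(L̂, ν_L)` of the reproducing kernel `exp ({σ, ·} / 2)`. -/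
def expoLp (σ : L) : Lp ℂ 2 J.νL :=
  (J.memLp_expo σ).toLp

theorem expoLp_ae_eq (σ : L) : J.expoLp σ =ᵐ[J.νL] J.expo σ :=
  (J.memLp_expo σ).coeFn_toLp

theorem expoLp_mem_H2 (σ : L) : J.expoLp σ ∈ J.H2 :=
  mem_H2_of_isHolCylinder (J.isHolCylinder_expo σ) (J.expoLp_ae_eq σ)

variable {J}

theorem IsHolCylinder.inner_expoLp_eq {f : J.LHat → ℂ} {F : Lp ℂ 2 J.νL} (hf : J.IsHolCylinder f)
    (hF : F =ᵐ[J.νL] f) (ξ : L) : inner ℂ (J.expoLp ξ) F = f (J.incl ξ) := by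
  rw [← hf.integral_conj_expo_mul ((memLp_congr_ae hF).1 (Lp.memLp F)) ξ, L2.inner_def]
  refine integral_congr_ae ?_
  filter_upwards [J.expoLp_ae_eq ξ, hF] with x hx hFx
  rw [hx, hFx, RCLike.inner_apply, mul_comm]

theorem inner_expoLp_expoLp (ξ τ : L) :
    inner ℂ (J.expoLp ξ) (J.expoLp τ) = J.expo τ (J.incl ξ) :=
  (J.isHolCylinder_expo τ).inner_expoLp_eq (J.expoLp_ae_eq τ) ξ

variable (J) in
/-- The functions in `L²(L̂, ν_L)` that depend only on the coordinates in `V ⊆ L` and are given on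
`V` by the reproducing kernel. Points of `L̂` with the same `V`-coordinates as `w ∈ V` stand in for
`w`, since `V` itself may be a null set. -/
def reproducedOn (V : Submodule ℝ L) : Submodule ℂ (Lp ℂ 2 J.νL) where
  carrier := {F | ∀ᵐ x ∂J.νL, ∀ w ∈ V, (∀ a ∈ V, J.coord a x = J.coord a (J.incl w)) →
    F x = inner ℂ (J.expoLp w) F}
  add_mem' {F G} hF hG := by
    filter_upwards [hF, hG, Lp.coeFn_add F G] with x hFx hGx h w hw hx
    rw [h, Pi.add_apply, hFx w hw hx, hGx w hw hx, inner_add_right]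
  zero_mem' := by
    filter_upwards [Lp.coeFn_zero ℂ 2 J.νL] with x h w _ _
    rw [h, Pi.zero_apply, inner_zero_right]
  smul_mem' c F hF := by
    filter_upwards [hF, Lp.coeFn_smul c F] with x hFx h w hw hx
    rw [h, Pi.smul_apply, hFx w hw hx, inner_smul_right, smul_eq_mul]

variable {V : Submodule ℝ L}

theorem IsHolCylinder.mem_reproducedOn {f : J.LHat → ℂ} {F : Lp ℂ 2 J.νL}
    (hf : J.IsHolCylinder f) (hF : F =ᵐ[J.νL] f)
    (hV : ∀ x y, (∀ a ∈ V, J.coord a x = J.coord a y) → f x = f y) : F ∈ J.reproducedOn V := by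
  filter_upwards [hF] with x hx w _ hxw
  rw [hx, hV x _ hxw, hf.inner_expoLp_eq hF]

theorem expoLp_mem_reproducedOn {v : L} (hv : v ∈ V) : J.expoLp v ∈ J.reproducedOn V :=
  (J.isHolCylinder_expo v).mem_reproducedOn (J.expoLp_ae_eq v) fun x y h => by
    rw [expo, expo, h v hv]

theorem isClosed_reproducedOn : IsClosed (J.reproducedOn V : Set (Lp ℂ 2 J.νL)) := by
  refine IsSeqClosed.isClosed fun u F hu hF => ?_
  obtain ⟨k, hk, hae⟩ := (tendstoInMeasure_of_tendsto_Lp hF).exists_seq_tendsto_ae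
  filter_upwards [hae, ae_all_iff.2 hu] with x hx hux w hw hxw
  have hinner := (tendsto_const_nhds (x := J.expoLp w)).inner (𝕜 := ℂ)
    (hF.comp hk.tendsto_atTop)
  exact tendsto_nhds_unique hx (hinner.congr fun i => (hux (k i) w hw hxw).symm)

theorem eq_zero_of_mem_reproducedOn [FiniteDimensional ℝ V] (hV : ∀ v ∈ V, J.J v ∈ V)
    {F : Lp ℂ 2 J.νL} (hF : F ∈ J.reproducedOn V) (h : ∀ w ∈ V, inner ℂ (J.expoLp w) F = 0) :
    F = 0 := by
  refine Lp.eq_zero_iff_ae_eq_zero.2 ?_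
  filter_upwards [hF] with x hx
  obtain ⟨w, hw, hxw⟩ := exists_coord_eq_coord_incl hV x
  rw [hx w hw hxw, h w hw, Pi.zero_apply]

theorem IsHolCylinder.mem_topologicalClosure_span_expoLp {f : J.LHat → ℂ} {F : Lp ℂ 2 J.νL}
    (hf : J.IsHolCylinder f) (hF : F =ᵐ[J.νL] f) :
    F ∈ (Submodule.span ℂ (Set.range J.expoLp)).topologicalClosure := by
  obtain ⟨n, σ, p, hp, hfp⟩ := hf
  obtain ⟨V, _, hVJ, hσ⟩ := J.exists_finiteDimensional_invariant σ
  let K := (Submodule.span ℂ (J.expoLp '' V)).topologicalClosure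
  have : CompleteSpace K := (Submodule.isClosed_topologicalClosure _).completeSpace_coe
  have hK : K ≤ J.reproducedOn V := Submodule.topologicalClosure_minimal _
    (Submodule.span_le.2 (Set.image_subset_iff.2 fun _ => expoLp_mem_reproducedOn))
    isClosed_reproducedOn
  have hFV : F ∈ J.reproducedOn V :=
    IsHolCylinder.mem_reproducedOn ⟨n, σ, p, hp, hfp⟩ hF fun x y h => by
      simp only [hfp, fun i => h (σ i) (hσ i)]
  obtain ⟨G, hG, H, hH, rfl⟩ := K.exists_add_mem_mem_orthogonal F
  have hH0 : H = 0 := by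
    refine eq_zero_of_mem_reproducedOn hVJ ?_ fun w hw => hH _ ?_
    · simpa using sub_mem hFV (hK hG)
    · exact Submodule.le_topologicalClosure _
        (Submodule.subset_span (Set.mem_image_of_mem _ hw))
  rw [hH0, add_zero]
  exact Submodule.topologicalClosure_mono
    (Submodule.span_mono (Set.image_subset_range _ _)) hG

theorem topologicalClosure_span_range_expoLp :
    (Submodule.span ℂ (Set.range J.expoLp)).topologicalClosure = J.H2 := by
  refine le_antisymm
    (Submodule.topologicalClosure_minimal _ (Submodule.span_le.2 ?_) isClosed_H2)
    (Submodule.topologicalClosure_minimal _ (Submodule.span_le.2 ?_)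
      (Submodule.isClosed_topologicalClosure _))
  · rintro _ ⟨σ, rfl⟩
    exact J.expoLp_mem_H2 σ
  · rintro F ⟨f, hf, hF⟩
    exact hf.mem_topologicalClosure_span_expoLp hF

theorem eq_zero_of_mem_H2_of_forall_inner_expoLp_eq_zero {F : Lp ℂ 2 J.νL} (hF : F ∈ J.H2)
    (h : ∀ ξ, inner ℂ (J.expoLp ξ) F = 0) : F = 0 := by
  have hle : J.H2 ≤ (ℂ ∙ F)ᗮ := by
    rw [← topologicalClosure_span_range_expoLp]
    exact Submodule.topologicalClosure_minimal _ (Submodule.span_le.2 (Set.range_subset_iff.2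
      fun ξ => Submodule.mem_orthogonal_singleton_iff_inner_left.2 (h ξ)))
      (Submodule.isClosed_orthogonal _)
  exact inner_self_eq_zero.1 (Submodule.mem_orthogonal_singleton_iff_inner_left.1 (hle hF))

theorem IsRestriction.mem_H2_and_eq_inner {F : Lp ℂ 2 J.νL} {h : L → ℂ}
    (hF : J.IsRestriction F h) : F ∈ J.H2 ∧ ∀ ξ, h ξ = inner ℂ (J.expoLp ξ) F := by
  obtain ⟨f, hf, hf2, hlim, hh⟩ := hF
  have hG : Tendsto (fun k => (hf2 k).toLp) atTop (𝓝 F) := by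
    rw [← Lp.toLp_coeFn F (Lp.memLp F)]
    exact (Lp.tendsto_Lp_iff_tendsto_eLpNorm'' f hf2 F (Lp.memLp F)).2 hlim
  refine ⟨isClosed_H2.mem_of_tendsto hG (Eventually.of_forall fun k =>
    mem_H2_of_isHolCylinder (hf k) (hf2 k).coeFn_toLp), fun ξ => ?_⟩
  have hinner := (tendsto_const_nhds (x := J.expoLp ξ)).inner (𝕜 := ℂ) hG
  exact tendsto_nhds_unique (hh ξ)
    (hinner.congr fun k => (hf k).inner_expoLp_eq (hf2 k).coeFn_toLp ξ)

theorem isRestriction_of_mem_H2 {F : Lp ℂ 2 J.νL} (hF : F ∈ J.H2) :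
    J.IsRestriction F fun ξ => inner ℂ (J.expoLp ξ) F := by
  obtain ⟨G, hG, hlim⟩ := mem_closure_iff_seq_limit.1 hF
  choose f hf hfG using fun k => exists_isHolCylinder_of_mem_span (hG k)
  refine ⟨f, hf, fun k => (memLp_congr_ae (hfG k)).1 (Lp.memLp _), ?_, fun ξ => ?_⟩
  · refine ((Lp.tendsto_Lp_iff_tendsto_eLpNorm' G F).1 hlim).congr fun k => ?_
    exact eLpNorm_congr_ae ((hfG k).sub EventuallyEq.rfl)
  · have hinner := (tendsto_const_nhds (x := J.expoLp ξ)).inner (𝕜 := ℂ) hlim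
    exact hinner.congr fun k => (hf k).inner_expoLp_eq (hfG k) ξ

theorem isRestriction_iff {F : Lp ℂ 2 J.νL} {h : L → ℂ} :
    J.IsRestriction F h ↔ F ∈ J.H2 ∧ ∀ ξ, h ξ = inner ℂ (J.expoLp ξ) F :=
  ⟨IsRestriction.mem_H2_and_eq_inner, fun ⟨hF, hh⟩ => funext hh ▸ isRestriction_of_mem_H2 hF⟩

variable (J)

/-- The element of `H²(L̂, ν_L)` representing the holomorphic coherent state of `τ` with respect to
the base point `η`. -/
def reducedCoherent (η τ : A) : J.H2 :=
  conj (J.α η τ) • ⟨J.expoLp (τ -ᵥ η), J.expoLp_mem_H2 _⟩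

theorem inner_reducedCoherent (η ζ : A) (F : J.H2) : inner ℂ (J.reducedCoherent η ζ) F =
    inner ℂ (J.expoLp (ζ -ᵥ η)) (F : Lp ℂ 2 J.νL) * J.α η ζ := by
  rw [Submodule.coe_inner, reducedCoherent, Submodule.coe_smul, inner_smul_left, Complex.conj_conj,
    mul_comm]

theorem represents_iff {η : A} {ψ : A → ℂ} {F : J.H2} :
    J.Represents η ψ F ↔ ψ = coefficients ℂ (J.reducedCoherent η) F := by
  simp only [Represents, isRestriction_iff, SetLike.coe_mem, true_and, funext_iff,
    coefficients_apply, inner_reducedCoherent]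
  exact ⟨fun ⟨h, hF, hψ⟩ ζ => by rw [hψ, hF], fun h => ⟨_, fun _ => rfl, h⟩⟩

theorem inner_reducedCoherent_reducedCoherent (η ζ ζ' : A) :
    inner ℂ (J.reducedCoherent η ζ) (J.reducedCoherent η ζ') = J.coherent ζ' ζ := by
  rw [inner_reducedCoherent, reducedCoherent, Submodule.coe_smul, inner_smul_right,
    inner_expoLp_expoLp, expo, coord_incl, α, α, coherent, ← Complex.exp_conj, ← Complex.exp_add,
    ← Complex.exp_add, T.θ_eq η ζ, T.θ_eq η ζ', T.θ_eq η ζ, T.θ_eq η ζ',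
    ← vsub_sub_vsub_cancel_right ζ ζ' η]
  generalize ζ -ᵥ η = v
  generalize ζ' -ᵥ η = w
  have hω : T.ω w v = 1 / 2 * (T.bracket w v - T.bracket v w) := rfl
  congr 1
  simp [hω, J.g.symm w v, Complex.conj_ofNat]
  ring

theorem inner_reducedCoherent_reducedCoherent_eq (η η' ζ ζ' : A) :
    inner ℂ (J.reducedCoherent η ζ) (J.reducedCoherent η ζ') =
      inner ℂ (J.reducedCoherent η' ζ) (J.reducedCoherent η' ζ') := by
  rw [inner_reducedCoherent_reducedCoherent, inner_reducedCoherent_reducedCoherent]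

theorem isTotalFamily_reducedCoherent (η : A) : IsTotalFamily ℂ (J.reducedCoherent η) := by
  refine isTotalFamily_of_forall_inner_eq_zero fun F hF =>
    Subtype.ext (eq_zero_of_mem_H2_of_forall_inner_expoLp_eq_zero F.2 fun ξ => ?_)
  have h := hF (ξ +ᵥ η)
  rw [inner_reducedCoherent, vadd_vsub] at h
  exact (mul_eq_zero.1 h).resolve_right (Complex.exp_ne_zero _)

theorem stateSpace_eq_range (η : A) :
    J.stateSpace = LinearMap.range (coefficients ℂ (J.reducedCoherent η)) := by
  ext ψ
  constructor
  · intro hψ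
    obtain ⟨F, hF, h⟩ := hψ η
    lift F to J.H2 using hF
    exact ⟨F, (J.represents_iff.1 h).symm⟩
  · intro hψ η'
    have hrange := (J.isTotalFamily_reducedCoherent η).range_coefficients_eq
      (J.isTotalFamily_reducedCoherent η') (J.inner_reducedCoherent_reducedCoherent_eq η η')
    obtain ⟨F, hF⟩ := hrange.le hψ
    exact ⟨F, F.2, J.represents_iff.2 hF.symm⟩

/-- The identification of the holomorphic state space with `H²(L̂, ν_L)` for the base point `η`. -/
def reduce (η : A) : J.stateSpace ≃ₗ[ℂ] J.H2 :=
  (LinearEquiv.ofInjective _ (J.isTotalFamily_reducedCoherent η).coefficients_injective ≪≫ₗ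
    LinearEquiv.ofEq _ _ (J.stateSpace_eq_range η).symm).symm

theorem coe_reduce_symm (η : A) (F : J.H2) :
    ((J.reduce η).symm F : A → ℂ) = coefficients ℂ (J.reducedCoherent η) F := rfl

theorem coefficients_reduce (η : A) (ψ : J.stateSpace) :
    coefficients ℂ (J.reducedCoherent η) (J.reduce η ψ) = ψ := by
  rw [← coe_reduce_symm, LinearEquiv.symm_apply_apply]

theorem reduce_eq_iff {η : A} {ψ : J.stateSpace} {F : J.H2} :
    J.reduce η ψ = F ↔ J.Represents η ψ F := by
  rw [represents_iff, ← coe_reduce_symm, SetLike.coe_eq_coe, LinearEquiv.eq_symm_apply]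

theorem norm_reduce (η η' : A) (ψ : J.stateSpace) : ‖J.reduce η ψ‖ = ‖J.reduce η' ψ‖ :=
  (J.isTotalFamily_reducedCoherent η).norm_eq_of_coefficients_eq
    (J.isTotalFamily_reducedCoherent η')
    (J.inner_reducedCoherent_reducedCoherent_eq η η')
    (by rw [coefficients_reduce, coefficients_reduce])

end ComplexStructure

/-! ### The Bargmann transform -/

namespace VacuumForm.IsAdmissible

variable {Ω : VacuumForm T} (hΩ : Ω.IsAdmissible) {J : ComplexStructure T} [CompleteSpace J.Space]

theorem inner_reduce_coherentState_eq_inner_reducedCoherent (hJ : J.Corresponds Ω) (η ζ ζ' : A) :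
    inner ℂ (hΩ.reduce η (hΩ.coherentState ζ)) (hΩ.reduce η (hΩ.coherentState ζ')) =
      inner ℂ (J.reducedCoherent η ζ) (J.reducedCoherent η ζ') := by
  rw [hΩ.inner_reduce_coherentState hJ, J.inner_reducedCoherent_reducedCoherent]

variable (hJ : J.Corresponds Ω)

/-- The isomorphism from the Schrödinger state space to the holomorphic state space that, after
reduction at the base point `η`, matches up the coherent states. -/
def bargmann (η : A) : hΩ.stateSpace ≃ₗ[ℂ] J.stateSpace :=
  hΩ.reduce η ≪≫ₗ ((hΩ.isTotalFamily_reduce_coherentState η).unitary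
    (J.isTotalFamily_reducedCoherent η)
    (hΩ.inner_reduce_coherentState_eq_inner_reducedCoherent hJ η)).toLinearEquiv ≪≫ₗ
  (J.reduce η).symm

theorem norm_reduce_bargmann (η η' : A) (Ψ : hΩ.stateSpace) :
    ‖J.reduce η' (hΩ.bargmann hJ η Ψ)‖ = ‖hΩ.reduce η' Ψ‖ := by
  rw [J.norm_reduce η' η, hΩ.norm_reduce η' η]
  simp [bargmann]

theorem bargmann_apply (η ζ : A) (Ψ : hΩ.stateSpace) : (hΩ.bargmann hJ η Ψ : A → ℂ) ζ =
    inner ℂ (hΩ.reduce η (hΩ.coherentState ζ)) (hΩ.reduce η Ψ) :=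
  congrFun ((hΩ.isTotalFamily_reduce_coherentState η).coefficients_unitary
    (J.isTotalFamily_reducedCoherent η)
    (hΩ.inner_reduce_coherentState_eq_inner_reducedCoherent hJ η) (hΩ.reduce η Ψ)) ζ

theorem bargmann_coherentState (η τ : A) :
    (hΩ.bargmann hJ η (hΩ.coherentState τ) : A → ℂ) = J.coherent τ := by
  ext ζ
  rw [bargmann_apply, hΩ.inner_reduce_coherentState hJ]

end VacuumForm.IsAdmissible

end AffineFieldTheory

end

/-- The Hilbert space structures on the two state spaces are those for which passing to the
representative at a base point `η` is unitary, onto `L²(Q̂, ν_Q)` by `S η` and onto `H²(L̂, ν_L)` by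
`H η`; it is part of the claim that `S η` and `H η` are bijections and that the norms do not depend
on `η`. The map `B` is the isometric isomorphism. -/
theorem mainTheorem1 {L A : Type*} [AddCommGroup L] [Module ℝ L] [AddTorsor L A]
    (T : Theory L A) (Ω : VacuumForm T) (hΩ : Ω.IsAdmissible) :
    (∃! J : ComplexStructure T, J.IsAdmissible ∧ J.Corresponds Ω) ∧
    ∀ J : ComplexStructure T, J.IsAdmissible → J.Corresponds Ω →
      ∃ (S : A → hΩ.stateSpace ≃ₗ[ℂ] MeasureTheory.Lp ℂ 2 Ω.νQ)
        (H : A → J.stateSpace ≃ₗ[ℂ] J.H2)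
        (B : hΩ.stateSpace ≃ₗ[ℂ] J.stateSpace),
        (∀ η Ψ, S η Ψ = (Ψ : A → MeasureTheory.Lp ℂ 2 Ω.νQ) η) ∧
        (∀ η ψ F, H η ψ = F ↔ J.Represents η ψ F) ∧
        (∀ η η' Ψ, ‖S η Ψ‖ = ‖S η' Ψ‖) ∧
        (∀ η η' ψ, ‖H η ψ‖ = ‖H η' ψ‖) ∧
        (∀ η Ψ, ‖H η (B Ψ)‖ = ‖S η Ψ‖) ∧
        ∀ τ, ∃ Ψ : hΩ.stateSpace, (∀ η, S η Ψ =ᵐ[Ω.νQ] hΩ.coherent τ η) ∧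
          (B Ψ : A → ℂ) = J.coherent τ := by
  refine ⟨hΩ.existsUnique_complexStructure, fun J hJ hJΩ => ?_⟩
  have := hJ.complete
  obtain ⟨η₀⟩ := AddTorsor.nonempty (G := L) (P := A)
  refine ⟨hΩ.reduce, J.reduce, hΩ.bargmann hJΩ η₀, fun _ _ => rfl, fun _ _ _ => J.reduce_eq_iff,
    hΩ.norm_reduce, J.norm_reduce, hΩ.norm_reduce_bargmann hJΩ η₀, fun τ => ?_⟩
  exact ⟨hΩ.coherentState τ, hΩ.reduce_coherentState_ae_eq τ,
    hΩ.bargmann_coherentState hJΩ η₀ τ⟩
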